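/- Activated random walk on $\mathbb{Z}$. Let $\lambda\in(0,\infty]$ (the sleep rate). A configuration $\eta$ assigns to each site $x\in\mathbb{Z}$ either a number $k\in\{0,1,2,\dots\}$ of active particles or exactly one sleeping particle; write $|\eta(x)|$ for the number of particles at $x$, active or asleep. Each site $x$ carries an infinite stack of instructions; all instructions are independent, and each one is "sleep" with probability $\frac{\lambda}{1+\lambda}$ (equal to $1$ if $\lambda=\infty$), "step to $x-1$" with probability $\frac{1}{2(1+\lambda)}$ and "step to $x+1$" with probability $\frac{1}{2(1+\lambda)}$. Firing a site $x$ means applying the first unused instruction of its stack: a step instruction moves one particle from $x$ to the given neighbour, where it wakes up the sleeping particle, if there is one; a sleep instruction puts the particle at $x$ to sleep if it is alone there and has no effect otherwise. A firing at $x$ is legal if $x$ holds at least one active particle. A configuration is stable if it has no active particles. Outer density. For $\zeta\in(0,1)$ let $\eta$ be the random configuration, independent of the stacks, that has, independently at each site, one active particle with probability $\zeta$ and no particle with probability $1-\zeta$. Let $w(x)\in\mathbb{N}\cup\{\infty\}$ be the number of firings at $x$ needed to stabilize $\eta$, that is, the supremum of the number of firings at $x$ over all finite sequences of legal firings starting from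 $\eta$. Writing $\mathbf{E}_\zeta$ for the expectation over the stacks and $\eta$, put $$\zeta_{out}=\zeta_{out}(\lambda):=\sup\{\zeta\in(0,1) : \mathbf{E}_\zeta(w(0)^3)<\infty\},\qquad \sup\emptyset:=0.$$ Inner density. For a finite nonempty interval $I\subset\mathbb{Z}$ start with one active particle at each site of $I$ and no particle elsewhere, and fire sites of $I$ legally until no active particle remains in $I$, where a particle that steps out of $I$ is removed. Let $|\mathcal{S}_I(\mathbf{1}_I)|$ be the number of (sleeping) particles that remain in $I$; almost surely this procedure ends, and its outcome does not depend on the order of the firings. Put $$\zeta_{in,I}:=\inf\left\{\zeta>0 : \mathbb{P}\left(|\mathcal{S}_I(\mathbf{1}_I)|>\zeta\,\# I\right)\le(\# I)^{-20}\right\},\qquad \zeta_{in}=\zeta_{in}(\lambda):=\limsup_{\# I\to\infty}\zeta_{in,I},$$ the upper limit being over all finite intervals $I\subset\mathbb{Z}$. Corollary. For every $\lambda\in(0,\infty]$, $$\zeta_{in}(\lambda)\ \ge\ \zeta_{out}(\lambda).$$ -/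

import Mathlib

open MeasureTheory Filter
open scoped ENNReal

noncomputable section

namespace ARW

/-- The content of a site: one sleeping particle, or `k` active particles
(`num 0` is an empty site). -/
inductive SiteState where
  | sleeping : SiteState
  | num (k : ℕ) : SiteState
  deriving DecidableEq

instance : MeasurableSpace SiteState := ⊤

/-- The instructions "fall asleep if alone", "step left", "step right". -/
inductive Instr where
  | sleep : Instr
  | left : Instr
  | right : Instr
  deriving DecidableEq

instance : MeasurableSpace Instr := ⊤

namespace SiteState

/-- The number of particles at the site, whatever their state (a sleeping one counts as one). -/
def count : SiteState → ℕ
  | sleeping => 1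
  | num k => k

/-- The site holds no active particle. -/
def IsStable : SiteState → Prop
  | sleeping => True
  | num k => k = 0

/-- An active particle arrives; a sleeping particle is woken up by it. -/
def arrive : SiteState → SiteState
  | sleeping => num 2
  | num k => num (k + 1)

/-- A particle leaves the site. -/
def depart : SiteState → SiteState
  | sleeping => num 0
  | num k => num (k - 1)

/-- The sleep instruction: it has an effect only on a particle that is alone. -/
def trySleep : SiteState → SiteState
  | sleeping => sleeping
  | num k => if k = 1 then sleeping else num k

end SiteState

/-- Configurations of activated random walkers on `ℤ`. -/
abbrev Config := ℤ → SiteState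

/-- The instruction stacks: `ρ (x, k)` is the instruction number `k` (counted from `0`) at `x`. -/
abbrev Stacks := ℤ × ℕ → Instr

/-- One particle moves from `x` to `y`; if `y` is outside `D` it is killed instead. -/
def moveParticle (D : Set ℤ) (η : Config) (x y : ℤ) : Config :=
  open Classical in
  if y ∈ D then Function.update (Function.update η x (η x).depart) y (η y).arrive
  else Function.update η x (η x).depart

/-- The effect on the configuration of applying an instruction at `x`,
with killing outside `D`. -/
def applyInstr (D : Set ℤ) (η : Config) (x : ℤ) : Instr → Config
  | .sleep => Function.update η x (η x).trySleep
  | .left => moveParticle D η x (x - 1)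
  | .right => moveParticle D η x (x + 1)

/-- Fire `x`: apply the first unused instruction of the stack at `x`. The second component of
the pair is the odometer: the number of instructions already used at each site. -/
def fire (D : Set ℤ) (ρ : Stacks) (x : ℤ) (s : Config × (ℤ → ℕ)) : Config × (ℤ → ℕ) :=
  (applyInstr D s.1 x (ρ (x, s.2 x)), Function.update s.2 x (s.2 x + 1))

/-- Fire the sites of a list one after the other. -/
def fireList (D : Set ℤ) (ρ : Stacks) (s : Config × (ℤ → ℕ)) : List ℤ → Config × (ℤ → ℕ)
  | [] => s
  | x :: α => fireList D ρ (fire D ρ x s) α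

/-- All the firings of the list are legal: each one takes place in `D`, at a site that holds an
active particle at that time. -/
def Legal (D : Set ℤ) (ρ : Stacks) (s : Config × (ℤ → ℕ)) : List ℤ → Prop
  | [] => True
  | x :: α => x ∈ D ∧ ¬ (s.1 x).IsStable ∧ Legal D ρ (fire D ρ x s) α

/-- `α` is a legal sequence of firings from `η` (with all stacks unused) after which no active
particle is left in `D`. -/
def Stabilizes (D : Set ℤ) (ρ : Stacks) (η : Config) (α : List ℤ) : Prop :=
  Legal D ρ (η, 0) α ∧ ∀ x ∈ D, ((fireList D ρ (η, 0) α).1 x).IsStable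

/-- The stabilization of `η` in `D`, with killing on leaving `D`: the final configuration of any
legal stabilizing sequence (it does not depend on the sequence). If there is no finite legal
stabilizing sequence, which on a finite interval has probability zero, the value is `η`. -/
def stabilization (D : Set ℤ) (ρ : Stacks) (η : Config) : Config :=
  open Classical in
  if h : ∃ α, Stabilizes D ρ η α then (fireList D ρ (η, 0) h.choose).1 else η

/-- The odometer of `η` on `ℤ`, with values in `ℕ ∪ {∞}`: the number of firings at `x` needed to
stabilize `η`, that is, the supremum of the number of firings at `x` over all finite legal
sequences (`η` may have infinitely many particles). -/
def odometer (ρ : Stacks) (η : Config) (x : ℤ) : ℕ∞ :=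
  ⨆ (α : List ℤ) (_ : Legal Set.univ ρ (η, 0) α), ((α.count x : ℕ) : ℕ∞)

/-- The law of one instruction at sleep rate `lam`: sleep with probability `lam / (1 + lam)`,
written as `1 - 1 / (1 + lam)` so that it is `1` for `lam = ∞`, and each of the two steps with
probability `1 / (2 (1 + lam))`. -/
def instrLaw (lam : ℝ≥0∞) : Measure Instr :=
  (1 - (1 + lam)⁻¹) • Measure.dirac Instr.sleep
    + (2 * (1 + lam))⁻¹ • Measure.dirac Instr.left
    + (2 * (1 + lam))⁻¹ • Measure.dirac Instr.right

instance (lam : ℝ≥0∞) : IsProbabilityMeasure (instrLaw lam) := by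
  constructor
  have h1 : (1 + lam)⁻¹ ≤ 1 := ENNReal.inv_le_one.2 le_self_add
  have h2 : (2 * (1 + lam))⁻¹ + (2 * (1 + lam))⁻¹ = (1 + lam)⁻¹ := by
    rw [ENNReal.mul_inv (by simp) (by simp), ← add_mul, ENNReal.inv_two_add_inv_two, one_mul]
  simp only [instrLaw, Measure.coe_add, Measure.coe_smul, Pi.add_apply, Pi.smul_apply,
    measure_univ, smul_eq_mul, mul_one]
  rw [add_assoc, h2, tsub_add_cancel_of_le h1]

/-- The law of the stacks: independent instructions. -/
def stacksLaw (lam : ℝ≥0∞) : Measure Stacks :=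
  Measure.infinitePi fun _ : ℤ × ℕ => instrLaw lam

/-- The law of the configuration with, independently at each site, one active particle with
probability `ζ` and no particle with probability `1 - ζ`. -/
def bernoulliConfigLaw (ζ : unitInterval) : Measure Config :=
  Measure.infinitePi fun _ : ℤ =>
    ProbabilityTheory.bernoulliMeasure (SiteState.num 1) (SiteState.num 0) ζ

/-- The outer density: the supremum of the `ζ` for which the odometer at `0` of the Bernoulli
configuration of density `ζ`, independent of the stacks, has a finite third moment. -/
def zetaOut (lam : ℝ≥0∞) : ℝ :=
  sSup {z : ℝ | ∃ ζ : unitInterval, (ζ : ℝ) = z ∧ 0 < ζ ∧ ζ < 1 ∧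
    ∫⁻ ω, ((odometer ω.1 ω.2 0 : ℕ∞) : ℝ≥0∞) ^ 3 ∂((stacksLaw lam).prod (bernoulliConfigLaw ζ))
      < ∞}

/-- One active particle at each site of `I`, no particle elsewhere. -/
def fullConfig (I : Finset ℤ) : Config :=
  fun x => if x ∈ I then SiteState.num 1 else SiteState.num 0

/-- The number of particles left in `I` after the stabilization of `fullConfig I` in `I`, with
killing on leaving `I`. -/
def survivors (I : Finset ℤ) (ρ : Stacks) : ℕ :=
  ∑ x ∈ I, (stabilization (I : Set ℤ) ρ (fullConfig I) x).count

/-- The inner density of the finite set `I` of sites. -/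
def zetaInOf (lam : ℝ≥0∞) (I : Finset ℤ) : ℝ :=
  sInf {ζ : ℝ | 0 < ζ ∧
    stacksLaw lam {ρ | ζ * (I.card : ℝ) < (survivors I ρ : ℝ)} ≤ ((I.card : ℝ≥0∞) ^ 20)⁻¹}

/-- The inner density: the upper limit of `zetaInOf lam I` over the intervals
`I = [a, b]` of `ℤ`, as the number of sites of `I` tends to infinity. -/
def zetaIn (lam : ℝ≥0∞) : ℝ :=
  limsup (fun p : ℤ × ℤ => zetaInOf lam (Finset.Icc p.1 p.2))
    (comap (fun p : ℤ × ℤ => (Finset.Icc p.1 p.2).card) atTop)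

end ARW

end

/-! Let `lam` be finite and suppose `zetaIn lam < z < ζ`, where the odometer at density `ζ` has a
finite third moment. Put `M` particles, slightly fewer than `2nζ`, at the origin of an interval `I`
of `2n` sites, cut into `2K` blocks of `b` sites. Two ways to stabilize this source give
contradictory particle counts.

The first way shows that few particles leave `I`. Fix a typical Bernoulli configuration `η` and
carry the source to `η`: fire, even asleep, any site of `I` with more particles than `η` has there.
The visited sites form an interval around `0` in which `η` has no unfilled place (hole). If a
particle left `I` on one side, all the holes would lie on the other side; as `η` has noticeably more
than `M` particles, the sum of the particle positions would be far from `0`. But this sum is a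
martingale with small fluctuations, and it is small for `η`. So no particle leaves
(`no_exit_of_carry`) and the carried configuration lies below `η`. The unused stacks are as good as
new (`measurePreserving_run`), hence a legal stabilization now needs at most the odometer of `η` at
each site; by the third moment this is below `N ≈ εn` on all of `I`, and only `O(εn)` particles
leave.

The second way is legal and cautious: a lone particle is fired only when its whole block has been
visited. By the exchange lemma `exists_continuation` (least action principle) it uses at each site
at most as many instructions as the first way, and lets no more particles out. A block that gets
fully visited passes through the state with a particle at every site, and by the Abelian property
its final state is the stabilization of the full block with unused stacks
(`eq_stabilization_fullConfig`). Since `z > zetaIn lam`, such a block keeps more than `zb` particles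
with probability at most `b ^ (-20)`. The rest of the line influences the block only through the
numbers `k`, `m` of particles entering at its two ends. They take polynomially many values, and for
each fixed pair the unused stacks are fresh, so a union bound applies. At most two blocks are partly
visited, and these hold at most one particle per site. Hence `M ≤ 2nz + 2b + O(εn)`
(`card_source_le`), which is false when `ε` is small compared with `ζ - z`.

For `lam = ∞` particles cannot be carried, but then nothing ever moves and the inner density is at
least `1`. -/

namespace ARW

/-! ### States of one site and their order. -/

namespace SiteState

/-- The position of a state in the order `0 < sleeping < 1 < 2 < ...`. -/
def rank : SiteState → ℕ
  | sleeping => 1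
  | num 0 => 0
  | num (k + 1) => k + 2

theorem isStable_iff {σ : SiteState} : σ.IsStable ↔ σ.rank ≤ 1 := by
  rcases σ with _ | _ | k <;> simp [IsStable, rank]

theorem not_isStable_iff {σ : SiteState} : ¬ σ.IsStable ↔ 2 ≤ σ.rank := by
  rw [isStable_iff]; omega

theorem one_le_count_iff {σ : SiteState} : 1 ≤ σ.count ↔ 1 ≤ σ.rank := by
  rcases σ with _ | _ | k <;> simp [count, rank]

theorem two_le_count_iff {σ : SiteState} : 2 ≤ σ.count ↔ 3 ≤ σ.rank := by
  rcases σ with _ | _ | k <;> simp [count, rank]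

theorem rank_mono_count {σ τ : SiteState} (h : σ.rank ≤ τ.rank) : σ.count ≤ τ.count := by
  rcases σ with _ | _ | k <;> rcases τ with _ | _ | m <;> simp [count, rank] at * <;> omega

theorem count_arrive (σ : SiteState) : σ.arrive.count = σ.count + 1 := by
  rcases σ with _ | k <;> simp [count, arrive]

theorem count_depart (σ : SiteState) : σ.depart.count = σ.count - 1 := by
  rcases σ with _ | k <;> simp [count, depart]

theorem count_trySleep (σ : SiteState) : σ.trySleep.count = σ.count := by
  rcases σ with _ | k
  · rfl
  · by_cases h : k = 1 <;> simp [count, trySleep, h]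

theorem rank_le_rank_arrive (σ : SiteState) : σ.rank ≤ σ.arrive.rank := by
  rcases σ with _ | _ | k <;> simp [rank, arrive]

theorem rank_arrive_mono {σ τ : SiteState} (h : σ.rank ≤ τ.rank) :
    σ.arrive.rank ≤ τ.arrive.rank := by
  rcases σ with _ | _ | k <;> rcases τ with _ | _ | m <;> simp [rank, arrive] at * <;> omega

/-- The effect of an instruction on the site that it is applied to. -/
def act : Instr → SiteState → SiteState
  | .sleep => trySleep
  | .left => depart
  | .right => depart

/-- The order is chosen for this: with a sleeping particle between an empty site and one active
particle, every instruction is monotone, and so is every arrival. -/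
theorem rank_act_mono (i : Instr) {σ τ : SiteState} (h : σ.rank ≤ τ.rank) :
    (act i σ).rank ≤ (act i τ).rank := by
  rcases i with _ | _ | _ <;> rcases σ with _ | _ | _ | k <;> rcases τ with _ | _ | _ | m <;>
    simp [rank, act, trySleep, depart] at * <;> omega

/-- This is the local source of the Abelian property. It fails at an empty site, where a sleep
instruction does nothing before the arrival but acts after it; hence all firing rules below require
a particle. -/
theorem act_arrive (i : Instr) {σ : SiteState} (h : 1 ≤ σ.count) :
    act i σ.arrive = (act i σ).arrive := by
  rcases i with _ | _ | _ <;> rcases σ with _ | _ | _ | k <;>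
    simp [act, trySleep, depart, arrive, count] at *

theorem count_act_le (i : Instr) (σ : SiteState) : (act i σ).count ≤ σ.count := by
  rcases i with _ | _ | _ <;> simp [act, count_trySleep, count_depart]

theorem le_count_act (i : Instr) (σ : SiteState) : σ.count - 1 ≤ (act i σ).count := by
  rcases i with _ | _ | _ <;> simp [act, count_trySleep, count_depart]

theorem iterate_arrive_num (m k : ℕ) : arrive^[k] (num m) = num (m + k) := by
  induction k generalizing m with
  | zero => rfl
  | succ k ih => rw [Function.iterate_succ_apply, arrive, ih]; congr 1; omega

theorem count_iterate_arrive (σ : SiteState) (k : ℕ) : (arrive^[k] σ).count = σ.count + k := by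
  induction k with
  | zero => rfl
  | succ k ih => rw [Function.iterate_succ_apply', count_arrive, ih]; omega

theorem rank_le_iterate_arrive (σ : SiteState) (k : ℕ) : σ.rank ≤ (arrive^[k] σ).rank := by
  induction k with
  | zero => rfl
  | succ k ih =>
    rw [Function.iterate_succ_apply']; exact ih.trans (rank_le_rank_arrive _)

theorem rank_iterate_arrive_mono (σ : SiteState) {k m : ℕ} (h : k ≤ m) :
    (arrive^[k] σ).rank ≤ (arrive^[m] σ).rank := by
  obtain ⟨d, rfl⟩ := Nat.exists_eq_add_of_le h
  rw [add_comm k d, Function.iterate_add_apply]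
  exact rank_le_iterate_arrive _ _

theorem act_iterate_arrive (i : Instr) {σ : SiteState} (h : 1 ≤ σ.count) (k : ℕ) :
    act i (arrive^[k] σ) = arrive^[k] (act i σ) := by
  induction k with
  | zero => rfl
  | succ k ih =>
    rw [Function.iterate_succ_apply', Function.iterate_succ_apply', act_arrive, ih]
    rw [count_iterate_arrive]; omega

end SiteState

open SiteState

/-! ### Firing rules, the Abelian property and the least action principle. -/

/-- The instruction `i`, applied at `x`, moves a particle from `x` to `z`. -/
def Moves (i : Instr) (x z : ℤ) : Prop :=
  (i = .left ∧ z = x - 1) ∨ (i = .right ∧ z = x + 1)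

theorem Moves.ne {i : Instr} {x z : ℤ} (h : Moves i x z) : z ≠ x := by
  rcases h with ⟨_, h⟩ | ⟨_, h⟩ <;> omega

open Classical in
theorem applyInstr_apply (D : Set ℤ) (c : Config) (x z : ℤ) (i : Instr) :
    applyInstr D c x i z =
      if z = x then act i (c x) else if z ∈ D ∧ Moves i x z then (c z).arrive else c z := by
  rcases i with _ | _ | _
  · by_cases h : z = x <;> simp [applyInstr, act, Moves, h]
  · by_cases h : z = x
    · subst h
      by_cases h' : z - 1 ∈ D <;> simp [applyInstr, act, moveParticle, h', Function.update]
      intro h; omega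
    · by_cases h' : x - 1 ∈ D <;> by_cases hz : z = x - 1 <;>
        simp [applyInstr, moveParticle, Moves, Function.update, h, h', hz]
  · by_cases h : z = x
    · subst h
      by_cases h' : z + 1 ∈ D <;> simp [applyInstr, act, moveParticle, h', Function.update]
    · by_cases h' : x + 1 ∈ D <;> by_cases hz : z = x + 1 <;>
        simp [applyInstr, moveParticle, Moves, Function.update, h, h', hz]

theorem applyInstr_self (D : Set ℤ) (c : Config) (x : ℤ) (i : Instr) :
    applyInstr D c x i x = act i (c x) := by
  simp [applyInstr_apply]

theorem rank_le_applyInstr (D : Set ℤ) (c : Config) {x z : ℤ} (i : Instr) (h : z ≠ x) :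
    (c z).rank ≤ (applyInstr D c x i z).rank := by
  rw [applyInstr_apply, if_neg h]
  split_ifs
  · exact rank_le_rank_arrive _
  · exact le_rfl

theorem applyInstr_mono (D : Set ℤ) {c c' : Config} (h : ∀ z, (c z).rank ≤ (c' z).rank) (x : ℤ)
    (i : Instr) (z : ℤ) : (applyInstr D c x i z).rank ≤ (applyInstr D c' x i z).rank := by
  rw [applyInstr_apply, applyInstr_apply]
  split_ifs
  · exact rank_act_mono i (h _)
  · exact rank_arrive_mono (h _)
  · exact h z

theorem applyInstr_comm (D : Set ℤ) (c : Config) {x y : ℤ} (i j : Instr) (hxy : x ≠ y)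
    (hx : 1 ≤ (c x).count) (hy : 1 ≤ (c y).count) :
    applyInstr D (applyInstr D c x i) y j = applyInstr D (applyInstr D c y j) x i := by
  funext z
  by_cases hzx : z = x
  · subst hzx
    simp only [applyInstr_apply, if_neg hxy, if_neg hxy.symm, if_true]
    split_ifs <;> simp [act_arrive, hx]
  by_cases hzy : z = y
  · subst hzy
    simp only [applyInstr_apply, if_neg hxy, if_neg hxy.symm, if_true]
    split_ifs <;> simp [act_arrive, hy]
  simp only [applyInstr_apply, if_neg hzx, if_neg hzy]
  split_ifs <;> rfl

/-- Configurations together with an odometer. -/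
abbrev State := Config × (ℤ → ℕ)

theorem fire_comm (D : Set ℤ) (ρ : Stacks) {s : State} {x y : ℤ} (hxy : x ≠ y)
    (hx : 1 ≤ (s.1 x).count) (hy : 1 ≤ (s.1 y).count) :
    fire D ρ y (fire D ρ x s) = fire D ρ x (fire D ρ y s) := by
  ext1
  · simp only [fire, Function.update_of_ne hxy, Function.update_of_ne hxy.symm]
    exact applyInstr_comm D s.1 _ _ hxy hx hy
  · simp only [fire, Function.update_of_ne hxy, Function.update_of_ne hxy.symm]
    exact Function.update_comm hxy _ _ _

/-- Every firing of the list takes place at a site whose state satisfies the rule `P`. -/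
def Admissible (D : Set ℤ) (P : ℤ → SiteState → Prop) (ρ : Stacks) (s : State) : List ℤ → Prop
  | [] => True
  | x :: α => P x (s.1 x) ∧ Admissible D P ρ (fire D ρ x s) α

/-- A rule that is preserved when the states increase. -/
def MonoRule (P : ℤ → SiteState → Prop) : Prop :=
  ∀ x σ τ, σ.rank ≤ τ.rank → P x σ → P x τ

/-- A rule under which a site is fired only if it holds a particle. -/
def ParticleRule (P : ℤ → SiteState → Prop) : Prop := ∀ x σ, P x σ → 1 ≤ σ.count

variable {D : Set ℤ} {P L A : ℤ → SiteState → Prop} {ρ : Stacks}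

theorem fireList_append (s : State) (α β : List ℤ) :
    fireList D ρ s (α ++ β) = fireList D ρ (fireList D ρ s α) β := by
  induction α generalizing s with
  | nil => rfl
  | cons x α ih => exact ih _

theorem admissible_append {s : State} {α β : List ℤ} :
    Admissible D P ρ s (α ++ β) ↔ Admissible D P ρ s α ∧ Admissible D P ρ (fireList D ρ s α) β := by
  induction α generalizing s with
  | nil => simp [Admissible, fireList]
  | cons x α ih => simp [Admissible, fireList, ih, and_assoc]

theorem Admissible.imp {Q : ℤ → SiteState → Prop} (h : ∀ x σ, P x σ → Q x σ) {s : State}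
    {α : List ℤ} (hα : Admissible D P ρ s α) : Admissible D Q ρ s α := by
  induction α generalizing s with
  | nil => trivial
  | cons x α ih => exact ⟨h _ _ hα.1, ih hα.2⟩

theorem Admissible.forall_mem {S : Set ℤ} (h : ∀ x σ, P x σ → x ∈ S) {s : State}
    {α : List ℤ} (hα : Admissible D P ρ s α) : ∀ x ∈ α, x ∈ S := by
  induction α generalizing s with
  | nil => simp
  | cons x α ih => simpa using ⟨h _ _ hα.1, ih hα.2⟩

theorem legal_iff_admissible {s : State} {α : List ℤ} :
    Legal D ρ s α ↔ Admissible D (fun x σ => x ∈ D ∧ ¬ σ.IsStable) ρ s α := by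
  induction α generalizing s with
  | nil => simp [Legal, Admissible]
  | cons x α ih => simp [Legal, Admissible, ih, and_assoc]

theorem fireList_odometer (s : State) (α : List ℤ) (x : ℤ) :
    (fireList D ρ s α).2 x = s.2 x + α.count x := by
  induction α generalizing s with
  | nil => simp [fireList]
  | cons y α ih =>
    rw [fireList, ih]
    by_cases h : x = y
    · subst h; simp [fire]; omega
    · simp [fire, h, Ne.symm h]

/-- A site that is not fired only receives particles, so its state can only grow. -/
theorem rank_le_fireList (s : State) {α : List ℤ} {x : ℤ} (hx : x ∉ α) :
    (s.1 x).rank ≤ ((fireList D ρ s α).1 x).rank := by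
  induction α generalizing s with
  | nil => exact le_rfl
  | cons y α ih =>
    simp only [List.mem_cons, not_or] at hx
    exact (rank_le_applyInstr D s.1 _ hx.1).trans (ih (fire D ρ y s) hx.2)

/-- A firing of `x` can be moved in front of firings of other sites. -/
theorem admissible_fire_front (hA : MonoRule A) (hA' : ParticleRule A) {s : State} {x : ℤ}
    (hx : 1 ≤ (s.1 x).count) {β : List ℤ} (hxβ : x ∉ β) (hβ : Admissible D A ρ s β) :
    Admissible D A ρ (fire D ρ x s) β ∧
      fireList D ρ (fire D ρ x s) β = fire D ρ x (fireList D ρ s β) := by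
  induction β generalizing s with
  | nil => exact ⟨trivial, rfl⟩
  | cons y β ih =>
    simp only [List.mem_cons, not_or] at hxβ
    have hy := hA' _ _ hβ.1
    have hcomm := fire_comm D ρ hxβ.1 hx hy
    have hx' : 1 ≤ ((fire D ρ y s).1 x).count :=
      hx.trans (rank_mono_count (rank_le_applyInstr D s.1 _ hxβ.1))
    obtain ⟨h1, h2⟩ := ih hx' hxβ.2 hβ.2
    refine ⟨⟨hA _ _ _ (rank_le_applyInstr D s.1 _ (Ne.symm hxβ.1)) hβ.1, ?_⟩, ?_⟩
    · rw [hcomm]; exact h1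
    · rw [fireList, hcomm, h2]; rfl

/-- The exchange lemma behind the Abelian property and the least action principle: if `β` is
`A`-admissible and ends in a state without `L`-admissible sites, then any `L`-admissible list `α`
can be continued in an `A`-admissible way to the state reached by `β`. -/
theorem exists_continuation (hL : MonoRule L) (hL' : ParticleRule L) (hA : MonoRule A)
    (hA' : ParticleRule A) {s : State} {α β : List ℤ} (hα : Admissible D L ρ s α)
    (hβ : Admissible D A ρ s β) (hend : ∀ x, ¬ L x ((fireList D ρ s β).1 x)) :
    ∃ γ, Admissible D A ρ (fireList D ρ s α) γ ∧
      fireList D ρ (fireList D ρ s α) γ = fireList D ρ s β := by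
  induction α generalizing s β with
  | nil => exact ⟨β, hβ, rfl⟩
  | cons x α ih =>
    -- Otherwise the state of `x` never decreases along `β`, and `x` would still be `L`-admissible
    -- at the end.
    have hxβ : x ∈ β := by
      by_contra hx
      exact hend x (hL _ _ _ (rank_le_fireList s hx) hα.1)
    -- The split is at the first occurrence of `x`. All firings before it are at other sites, so
    -- this firing can be moved to the front and then matched with the head of `α`.
    obtain ⟨β₁, β₂, rfl, hx⟩ := List.eq_append_cons_of_mem hxβ
    rw [admissible_append] at hβ
    obtain ⟨h1, h2⟩ := admissible_fire_front hA hA' (hL' _ _ hα.1) hx hβ.1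
    have h3 : fireList D ρ s (β₁ ++ x :: β₂) = fireList D ρ (fire D ρ x s) (β₁ ++ β₂) := by
      rw [fireList_append, fireList_append, h2]; rfl
    rw [h3] at hend
    obtain ⟨γ, hγ, hγ'⟩ := ih hα.2 (admissible_append.2 ⟨h1, h2 ▸ hβ.2.2⟩) hend
    exact ⟨γ, hγ, by rw [h3]; exact hγ'⟩

theorem count_le_of_exists_continuation {s : State} {α β γ : List ℤ}
    (h : fireList D ρ (fireList D ρ s α) γ = fireList D ρ s β) (x : ℤ) :
    α.count x ≤ β.count x := by
  have h1 := congrFun (congrArg Prod.snd h) x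
  simp only [fireList_odometer] at h1
  omega

/-- Admissible lists remain admissible when the initial configuration increases. -/
theorem Admissible.mono (hP : MonoRule P) {s s' : State} (h1 : ∀ x, (s.1 x).rank ≤ (s'.1 x).rank)
    (h2 : s.2 = s'.2) {α : List ℤ} (hα : Admissible D P ρ s α) :
    Admissible D P ρ s' α ∧
      ∀ x, ((fireList D ρ s α).1 x).rank ≤ ((fireList D ρ s' α).1 x).rank := by
  induction α generalizing s s' with
  | nil => exact ⟨trivial, h1⟩
  | cons x α ih =>
    have h3 : ∀ z, ((fire D ρ x s).1 z).rank ≤ ((fire D ρ x s').1 z).rank := by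
      intro z
      simp only [fire, h2]
      exact applyInstr_mono D h1 x _ z
    obtain ⟨h4, h5⟩ := ih (s' := fire D ρ x s') h3 (by simp [fire, h2]) hα.2
    exact ⟨⟨hP _ _ _ (h1 x) hα.1, h4⟩, h5⟩

theorem monoRule_active (S : Set ℤ) : MonoRule fun x σ => x ∈ S ∧ ¬ σ.IsStable := by
  intro x σ τ h ⟨h1, h2⟩
  rw [not_isStable_iff] at *
  exact ⟨h1, by omega⟩

theorem particleRule_active (S : Set ℤ) : ParticleRule fun x σ => x ∈ S ∧ ¬ σ.IsStable := by
  intro x σ ⟨h1, h2⟩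
  rw [not_isStable_iff] at h2
  rw [one_le_count_iff]; omega

/-- Three choices of `κ` are used: the counts of `η` (carry particles to `η`), the constant `1`
(fill a block without putting anything to sleep) and the constant `0` (fire any particle, even
asleep). -/
theorem monoRule_le_count (S : Set ℤ) (κ : ℤ → ℕ) : MonoRule fun x σ => x ∈ S ∧ κ x < σ.count :=
  fun _ _ _ h h' => ⟨h'.1, h'.2.trans_le (rank_mono_count h)⟩

theorem particleRule_le_count (S : Set ℤ) (κ : ℤ → ℕ) :
    ParticleRule fun x σ => x ∈ S ∧ κ x < σ.count := fun _ _ h => Nat.one_le_of_lt h.2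

/-- The stabilization is the final configuration of any stabilizing list. -/
theorem stabilization_eq {η : Config} {α : List ℤ} (h : Stabilizes D ρ η α) :
    stabilization D ρ η = (fireList D ρ (η, 0) α).1 := by
  have hex : ∃ α, Stabilizes D ρ η α := ⟨α, h⟩
  rw [stabilization, dif_pos hex]
  have h' := hex.choose_spec
  obtain ⟨γ, hγ, hγ'⟩ := exists_continuation (monoRule_active D) (particleRule_active D)
    (monoRule_active D) (particleRule_active D) (legal_iff_admissible.1 h.1)
    (legal_iff_admissible.1 h'.1) (fun x hx => hx.2 (h'.2 x hx.1))
  -- The continuation is empty, since nothing can be fired legally after a stabilizing list.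
  rcases γ with _ | ⟨x, γ⟩
  · rw [← hγ']; rfl
  · exact absurd (h.2 x hγ.1.1) hγ.1.2

/-- The stacks that remain after the use of the first `u x` instructions of each site `x`. -/
def dropStacks (u : ℤ → ℕ) (ρ : Stacks) : Stacks := fun e => ρ (e.1, u e.1 + e.2)

theorem dropStacks_zero (ρ : Stacks) : dropStacks 0 ρ = ρ := by
  funext e; simp [dropStacks]

/-- This resets the odometer: to go on after `u` is to start afresh with the truncated stacks. -/
theorem fireList_dropStacks (c : Config) (u v : ℤ → ℕ) (α : List ℤ) :
    fireList D ρ (c, u + v) α = ((fireList D (dropStacks u ρ) (c, v) α).1,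
      u + (fireList D (dropStacks u ρ) (c, v) α).2) := by
  induction α generalizing c v with
  | nil => rfl
  | cons x α ih =>
    simp only [fireList, fire]
    rw [← ih]
    congr 2
    funext y
    by_cases h : y = x
    · subst h; simp; omega
    · simp [h]

theorem admissible_dropStacks {c : Config} {u v : ℤ → ℕ} {α : List ℤ} :
    Admissible D P ρ (c, u + v) α ↔ Admissible D P (dropStacks u ρ) (c, v) α := by
  induction α generalizing c v with
  | nil => simp [Admissible]
  | cons x α ih =>
    simp only [Admissible, fire]
    rw [← ih]
    have : Function.update (u + v) x ((u + v) x + 1) = u + Function.update v x (v x + 1) := by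
      funext y
      by_cases h : y = x
      · subst h; simp; omega
      · simp [h]
    rw [this]; rfl

/-- If the lengths of the lists with a property are bounded, then one of them is maximal. -/
theorem exists_maximal_list {p : List ℤ → Prop} (h0 : p []) (N : ℕ)
    (hN : ∀ α, p α → α.length ≤ N) : ∃ α, p α ∧ ∀ x, ¬ p (α ++ [x]) := by
  classical
  have hex : ∃ k, ∃ α, p α ∧ N - α.length = k := ⟨_, [], h0, rfl⟩
  obtain ⟨α, hα, hk⟩ := Nat.find_spec hex
  refine ⟨α, hα, fun x hx => ?_⟩
  have h1 := hN _ hx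
  have h2 := Nat.find_min' hex ⟨_, hx, rfl⟩
  rw [← hk] at h2
  simp at h1 h2
  omega

theorem length_le_sum_count (S : Finset ℤ) {α : List ℤ} (h : ∀ x ∈ α, x ∈ S) :
    α.length ≤ ∑ x ∈ S, α.count x := by
  rw [← Multiset.coe_card, ← Multiset.sum_count_eq_card (s := S) (by simpa using h)]
  simp

end ARW

/-! ### Restriction to an interval, visited sites, and filled blocks. -/

namespace ARW

open SiteState

variable {D : Set ℤ} {P : ℤ → SiteState → Prop} {ρ : Stacks}

/-- The number of firings of `z` in a list at which the instruction `i` is applied. -/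
def inflow (ρ : Stacks) (z : ℤ) (i : Instr) : (ℤ → ℕ) → List ℤ → ℕ
  | _, [] => 0
  | u, x :: α => (if x = z ∧ ρ (x, u x) = i then 1 else 0) +
      inflow ρ z i (Function.update u x (u x + 1)) α

theorem inflow_le_count (z : ℤ) (i : Instr) (u : ℤ → ℕ) (α : List ℤ) :
    inflow ρ z i u α ≤ α.count z := by
  induction α generalizing u with
  | nil => simp [inflow]
  | cons x α ih =>
    have := ih (Function.update u x (u x + 1))
    rw [inflow, List.count_cons]
    by_cases h : x = z
    · simp only [h, true_and, beq_self_eq_true, if_true] at *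
      split_ifs <;> omega
    · simp [h, this]

theorem inflow_le_append (z : ℤ) (i : Instr) (u : ℤ → ℕ) (α β : List ℤ) :
    inflow ρ z i u α ≤ inflow ρ z i u (α ++ β) := by
  induction α generalizing u with
  | nil => simp [inflow]
  | cons x α ih => simpa [inflow] using ih _

/-- `k` arrivals at `l` and `m` arrivals at `r`. -/
def endArrivals (l r : ℤ) (k m : ℕ) (x : ℤ) : ℕ :=
  (if x = l then k else 0) + (if x = r then m else 0)

/-- The firings in an interval, with killing outside, reproduce the configuration in the interval
if the particles that enter it are added at the beginning. -/
theorem fireList_filter_Icc (hP : MonoRule P) (hP' : ParticleRule P) {l r : ℤ} (hlr : l ≤ r)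
    {s t : State} {α : List ℤ}
    (ht : ∀ x ∈ Set.Icc l r, t.1 x = arrive^[endArrivals l r (inflow ρ (l - 1) .right s.2 α)
      (inflow ρ (r + 1) .left s.2 α) x] (s.1 x))
    (ht' : ∀ x ∈ Set.Icc l r, t.2 x = s.2 x) (hα : Admissible Set.univ P ρ s α) :
    Admissible (Set.Icc l r) (fun x σ => x ∈ Set.Icc l r ∧ P x σ) ρ t
        (α.filter fun x => l ≤ x ∧ x ≤ r) ∧
      ∀ x ∈ Set.Icc l r, (fireList (Set.Icc l r) ρ t (α.filter fun x => l ≤ x ∧ x ≤ r)).1 x =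
        (fireList Set.univ ρ s α).1 x := by
  classical
  induction α generalizing s t with
  | nil =>
    refine ⟨trivial, fun x hx => ?_⟩
    simpa [inflow, endArrivals, fireList] using ht x hx
  | cons x α ih =>
    by_cases hx : x ∈ Set.Icc l r
    · have hx' : l ≤ x ∧ x ≤ r := hx
      have hk : inflow ρ (l - 1) .right s.2 (x :: α) =
          inflow ρ (l - 1) .right (fire Set.univ ρ x s).2 α := by
        rw [inflow, if_neg (by omega), zero_add]; rfl
      have hm : inflow ρ (r + 1) .left s.2 (x :: α) =
          inflow ρ (r + 1) .left (fire Set.univ ρ x s).2 α := by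
        rw [inflow, if_neg (by omega), zero_add]; rfl
      rw [hk, hm] at ht
      rw [List.filter_cons_of_pos (by simpa using hx')]
      have hcount := hP' _ _ hα.1
      have g1 : ∀ z ∈ Set.Icc l r, (fire (Set.Icc l r) ρ x t).1 z =
          arrive^[endArrivals l r (inflow ρ (l - 1) .right (fire Set.univ ρ x s).2 α)
            (inflow ρ (r + 1) .left (fire Set.univ ρ x s).2 α) z] ((fire Set.univ ρ x s).1 z) := by
        intro z hz
        generalize inflow ρ (l - 1) .right (fire Set.univ ρ x s).2 α = a at *
        generalize inflow ρ (r + 1) .left (fire Set.univ ρ x s).2 α = b at *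
        simp only [fire]
        rw [applyInstr_apply, applyInstr_apply, ht' x hx]
        by_cases hzx : z = x
        · subst hzx
          rw [if_pos rfl, if_pos rfl, ht z hz, act_iterate_arrive _ hcount]
        · simp only [if_neg hzx, hz, Set.mem_univ, true_and]
          split_ifs
          · rw [ht z hz, ← Function.iterate_succ_apply' arrive, Function.iterate_succ_apply]
          · tauto
      have g2 : ∀ z ∈ Set.Icc l r,
          (fire (Set.Icc l r) ρ x t).2 z = (fire Set.univ ρ x s).2 z := by
        intro z hz
        by_cases hzx : z = x
        · subst hzx; simp [fire, ht' z hz]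
        · simp [fire, hzx, ht' z hz]
      obtain ⟨h1, h2⟩ := ih g1 g2 hα.2
      refine ⟨⟨⟨hx, hP _ _ _ ?_ hα.1⟩, h1⟩, h2⟩
      rw [ht x hx]; exact rank_le_iterate_arrive _ _
    · have hx' : ¬ (l ≤ x ∧ x ≤ r) := hx
      rw [List.filter_cons_of_neg (by simpa using hx')]
      have g1 : ∀ z ∈ Set.Icc l r, t.1 z =
          arrive^[endArrivals l r (inflow ρ (l - 1) .right (fire Set.univ ρ x s).2 α)
            (inflow ρ (r + 1) .left (fire Set.univ ρ x s).2 α) z] ((fire Set.univ ρ x s).1 z) := by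
        intro z hz
        have hzx : z ≠ x := by rintro rfl; exact hx hz
        have hz' : l ≤ z ∧ z ≤ r := hz
        -- A firing outside the interval is dropped from the filtered list; the particle that it may
        -- send in was already credited to `t`, so one pending arrival becomes a real one.
        have key : endArrivals l r (inflow ρ (l - 1) .right s.2 (x :: α))
            (inflow ρ (r + 1) .left s.2 (x :: α)) z =
            endArrivals l r (inflow ρ (l - 1) .right (fire Set.univ ρ x s).2 α)
            (inflow ρ (r + 1) .left (fire Set.univ ρ x s).2 α) z +
            (if Moves (ρ (x, s.2 x)) x z then 1 else 0) := by
          have e1 : (z = l ∧ x = l - 1 ∧ ρ (x, s.2 x) = .right ∨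
              z = r ∧ x = r + 1 ∧ ρ (x, s.2 x) = .left) ↔ Moves (ρ (x, s.2 x)) x z := by
            simp only [Moves]
            constructor
            · rintro (⟨h1, h2, h3⟩ | ⟨h1, h2, h3⟩)
              · exact Or.inr ⟨h3, by omega⟩
              · exact Or.inl ⟨h3, by omega⟩
            · rintro (⟨h1, h2⟩ | ⟨h1, h2⟩)
              · exact Or.inr ⟨by omega, by omega, h1⟩
              · exact Or.inl ⟨by omega, by omega, h1⟩
          have e2 : ¬ (x = l - 1 ∧ x = r + 1) := by omega
          simp only [endArrivals, inflow, fire, ← e1]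
          generalize inflow ρ (l - 1) .right (Function.update s.2 x (s.2 x + 1)) α = a
          generalize inflow ρ (r + 1) .left (Function.update s.2 x (s.2 x + 1)) α = b
          by_cases p : ρ (x, s.2 x) = .right <;> by_cases q : ρ (x, s.2 x) = .left <;>
            simp only [p, q, and_true, and_false, or_false] <;> split_ifs <;>
            first | omega | tauto
        rw [ht z hz, key]
        simp only [fire]
        rw [applyInstr_apply, if_neg hzx]
        simp only [Set.mem_univ, true_and]
        split_ifs
        · rw [Function.iterate_succ_apply]
        · rfl
      refine ih g1 (fun z hz => ?_) hα.2
      have hzx : z ≠ x := by rintro rfl; exact hx hz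
      simp [fire, hzx, ht' z hz]

/-- The site holds a particle or has been fired. -/
def Visited (s : State) (x : ℤ) : Prop := 1 ≤ (s.1 x).count ∨ 1 ≤ s.2 x

theorem Visited.fire {s : State} {y : ℤ} (h : Visited s y) (x : ℤ) :
    Visited (ARW.fire D ρ x s) y := by
  by_cases hy : y = x
  · subst hy; right; simp [ARW.fire]
  · rcases h with h | h
    · exact Or.inl (h.trans (rank_mono_count (rank_le_applyInstr D s.1 _ hy)))
    · right; simpa [ARW.fire, hy] using h

theorem visited_of_fire {s : State} {x y : ℤ} (hx : Visited s x)
    (h : Visited (ARW.fire D ρ x s) y) : Visited s y ∨ y = x - 1 ∨ y = x + 1 := by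
  by_cases hyx : y = x
  · subst hyx; exact Or.inl hx
  · rcases h with h | h
    · simp only [fire] at h
      rw [applyInstr_apply, if_neg hyx] at h
      split_ifs at h with h'
      · rcases h'.2 with ⟨_, h'⟩ | ⟨_, h'⟩ <;> simp [h']
      · exact Or.inl (Or.inl h)
    · left; right; simpa [fire, hyx] using h

/-- The visited sites form an interval that contains `0` unless it is empty. -/
def IntervalVisited (s : State) : Prop :=
  (∀ y, 0 < y → Visited s y → Visited s (y - 1)) ∧ ∀ y, y < 0 → Visited s y → Visited s (y + 1)

/-- A firing can add only neighbours of the fired site to the visited set, and that site was itself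
visited. -/
theorem IntervalVisited.fire {s : State} {x : ℤ} (h : IntervalVisited s) (hx : Visited s x) :
    IntervalVisited (ARW.fire D ρ x s) := by
  constructor
  · intro y hy hv
    rcases visited_of_fire hx hv with h' | h' | h'
    · exact (h.1 y hy h').fire x
    · have := h.1 x (by omega) hx
      rw [← h'] at this
      exact (h.1 y hy this).fire x
    · rw [h', add_sub_cancel_right]; exact hx.fire x
  · intro y hy hv
    rcases visited_of_fire hx hv with h' | h' | h'
    · exact (h.2 y hy h').fire x
    · rw [h', sub_add_cancel]; exact hx.fire x
    · have := h.2 x (by omega) hx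
      rw [← h'] at this
      exact (h.2 y hy this).fire x

theorem IntervalVisited.fireList (hP : ParticleRule P) {s : State} (h : IntervalVisited s)
    {α : List ℤ} (hα : Admissible D P ρ s α) : IntervalVisited (ARW.fireList D ρ s α) := by
  induction α generalizing s with
  | nil => exact h
  | cons x α ih => exact ih (h.fire (Or.inl (hP _ _ hα.1))) hα.2

theorem IntervalVisited.of_nonneg_le {s : State} (h : IntervalVisited s) {y z : ℤ} (hy : 0 ≤ y)
    (hyz : y ≤ z) (hz : Visited s z) : Visited s y := by
  induction z, hyz using Int.leInduction with
  | base => exact hz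
  | succ z hyz ih => exact ih (by simpa using h.1 (z + 1) (by omega) hz)

theorem IntervalVisited.of_le_nonpos {s : State} (h : IntervalVisited s) {y z : ℤ} (hy : y ≤ 0)
    (hyz : z ≤ y) (hz : Visited s z) : Visited s y := by
  induction z, hyz using Int.leInductionDown with
  | base => exact hz
  | pred z hyz ih => exact ih (by simpa using h.2 (z - 1) (by omega) hz)

/-- If a site `x` is fired only when it holds more than `κ x` particles, with `κ x ≤ 1`, then a
visited site holds at least `κ x` particles. -/
theorem le_count_of_visited {κ : ℤ → ℕ} (hκ : ∀ x, κ x ≤ 1)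
    (hP : ∀ x σ, P x σ → κ x < σ.count) {s : State} {α : List ℤ}
    (h : ∀ y, Visited s y → κ y ≤ (s.1 y).count) (hα : Admissible D P ρ s α) :
    ∀ y, Visited (fireList D ρ s α) y → κ y ≤ ((fireList D ρ s α).1 y).count := by
  induction α generalizing s with
  | nil => exact h
  | cons x α ih =>
    refine ih (fun y hy => ?_) hα.2
    have hx := hP _ _ hα.1
    by_cases hyx : y = x
    · subst hyx
      simp only [fire]
      rw [applyInstr_self]
      have := le_count_act (ρ (y, s.2 y)) (s.1 y)
      omega
    · rcases hy with hy | hy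
      · exact (hκ y).trans hy
      · have hv : Visited s y := by right; simpa [fire, hyx] using hy
        exact (h y hv).trans (rank_mono_count (rank_le_applyInstr D s.1 _ hyx))

theorem Admissible.one_le_count {S : Set ℤ} (hP : ∀ x ∈ S, ∀ σ, P x σ → 2 ≤ σ.count) {s : State}
    {α : List ℤ} (h : ∀ y ∈ S, 1 ≤ (s.1 y).count) (hα : Admissible D P ρ s α) :
    ∀ y ∈ S, 1 ≤ ((fireList D ρ s α).1 y).count := by
  induction α generalizing s with
  | nil => exact h
  | cons x α ih =>
    refine ih (fun y hy => ?_) hα.2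
    by_cases hyx : y = x
    · subst hyx
      have := hP _ hy _ hα.1
      simp only [fire]
      rw [applyInstr_self]
      have := le_count_act (ρ (y, s.2 y)) (s.1 y)
      omega
    · exact (h y hy).trans (rank_mono_count (rank_le_applyInstr D s.1 _ hyx))

/-- A sleep instruction is void at a site with two particles, so filling a block creates no sleepers
and ends with active particles, as in `fullConfig`. -/
theorem Admissible.ne_sleeping (hP : ∀ x σ, P x σ → 2 ≤ σ.count) {s : State}
    {α : List ℤ} (h : ∀ y, s.1 y ≠ sleeping) (hα : Admissible D P ρ s α) :
    ∀ y, (fireList D ρ s α).1 y ≠ sleeping := by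
  induction α generalizing s with
  | nil => exact h
  | cons x α ih =>
    refine ih (fun y => ?_) hα.2
    simp only [fire]
    rw [applyInstr_apply]
    have h1 := hP _ _ hα.1
    have hx := h x
    have hy := h y
    split_ifs
    · generalize ρ (x, s.2 x) = i
      generalize s.1 x = σ at *
      rcases σ with _ | _ | _ | k <;> rcases i with _ | _ | _ <;>
        simp [count, act, trySleep, depart] at *
    · generalize s.1 y = σ at *
      rcases σ with _ | k <;> simp [arrive] at *
    · exact hy

theorem Admissible.eq_of_not_mem (hP : ∀ x σ, P x σ → x ∈ D) {s : State} {α : List ℤ}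
    (hα : Admissible D P ρ s α) {y : ℤ} (hy : y ∉ D) : (fireList D ρ s α).1 y = s.1 y := by
  induction α generalizing s with
  | nil => rfl
  | cons x α ih =>
    have hx : y ≠ x := by rintro rfl; exact hy (hP _ _ hα.1)
    rw [fireList, ih hα.2]
    simp only [fire]
    rw [applyInstr_apply, if_neg hx, if_neg (by tauto)]

/-- If an interval is full at some time, up to which its sites are fired only when they hold at
least two particles, and stable in the end, then its final configuration is a stabilization of the
full configuration, with the stacks left by any way to fill it. -/
theorem eq_stabilization_fullConfig {l r : ℤ} (hlr : l ≤ r) {X Y : Config} {α₁ α₂ β : List ℤ}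
    {I : Set ℤ} (hX : ∀ y, X y ≠ sleeping)
    (hY : ∀ x ∈ Set.Icc l r, Y x = arrive^[endArrivals l r
      (inflow ρ (l - 1) .right 0 (α₁ ++ α₂)) (inflow ρ (r + 1) .left 0 (α₁ ++ α₂)) x] (X x))
    (hY' : ∀ x, x ∉ Set.Icc l r → Y x = num 0)
    (hα₁ : Admissible Set.univ
      (fun x σ => (x ∈ I ∧ ¬ σ.IsStable) ∧ (x ∈ Set.Icc l r → 2 ≤ σ.count)) ρ (X, 0) α₁)
    (hfull : ∀ x ∈ Set.Icc l r, 1 ≤ ((fireList Set.univ ρ (X, 0) α₁).1 x).count)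
    (hα : Admissible Set.univ (fun x σ => x ∈ I ∧ ¬ σ.IsStable) ρ (X, 0) (α₁ ++ α₂))
    (hstable : ∀ x ∈ Set.Icc l r, ((fireList Set.univ ρ (X, 0) (α₁ ++ α₂)).1 x).IsStable)
    (hβ : Admissible (Set.Icc l r) (fun x σ => x ∈ Set.Icc l r ∧ 1 < σ.count) ρ (Y, 0) β)
    (hβ' : ∀ x ∈ Set.Icc l r, ((fireList (Set.Icc l r) ρ (Y, 0) β).1 x).count ≤ 1) :
    ∀ x ∈ Set.Icc l r, stabilization (Set.Icc l r)
      (dropStacks (fireList (Set.Icc l r) ρ (Y, 0) β).2 ρ) (fullConfig (Finset.Icc l r)) x =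
      (fireList Set.univ ρ (X, 0) (α₁ ++ α₂)).1 x := by
  set B := Set.Icc l r with hB
  obtain ⟨h1, h2⟩ := fireList_filter_Icc (monoRule_active I) (particleRule_active I) hlr
    (s := (X, 0)) (t := (Y, 0)) hY (fun _ _ => rfl) hα
  have h1' : Admissible B (fun x σ => x ∈ B ∧ ¬ σ.IsStable) ρ (Y, 0)
      ((α₁ ++ α₂).filter fun x => l ≤ x ∧ x ≤ r) := h1.imp fun x σ h => ⟨h.1, h.2.2⟩
  have hm : MonoRule fun x σ => (x ∈ I ∧ ¬ σ.IsStable) ∧ (x ∈ B → 2 ≤ σ.count) :=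
    fun x σ τ h h' => ⟨monoRule_active I x σ τ h h'.1, fun hx =>
      (h'.2 hx).trans (rank_mono_count h)⟩
  have hp : ParticleRule fun x σ => (x ∈ I ∧ ¬ σ.IsStable) ∧ (x ∈ B → 2 ≤ σ.count) :=
    fun x σ h => particleRule_active I x σ h.1
  classical
  -- `Y₁` receives only the particles that enter during `α₁`, whereas `Y` receives all those of `α₁
  -- ++ α₂`; monotonicity carries the filling from `Y₁` over to `Y`.
  set Y₁ : Config := fun x => if x ∈ B then arrive^[endArrivals l r
      (inflow ρ (l - 1) .right 0 α₁) (inflow ρ (r + 1) .left 0 α₁) x] (X x) else num 0 with hY₁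
  obtain ⟨h3, h4⟩ := fireList_filter_Icc hm hp hlr (s := (X, 0)) (t := (Y₁, 0))
    (fun x hx => by simp only [hY₁]; rw [if_pos hx]) (fun _ _ => rfl) hα₁
  have h3' := h3.imp (Q := fun x σ => x ∈ B ∧ 1 < σ.count) fun x σ h => ⟨h.1, h.2.2 h.1⟩
  have hle : ∀ x, (Y₁ x).rank ≤ (Y x).rank := by
    intro x
    simp only [hY₁]
    split_ifs with hx
    · rw [hY x hx]
      refine rank_iterate_arrive_mono _ ?_
      unfold endArrivals
      have e1 := inflow_le_append (ρ := ρ) (l - 1) .right 0 α₁ α₂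
      have e2 := inflow_le_append (ρ := ρ) (r + 1) .left 0 α₁ α₂
      split_ifs <;> omega
    · rw [hY' x hx]
  obtain ⟨h5, h6⟩ := h3'.mono (monoRule_le_count B fun _ => 1) (s := (Y₁, 0)) (s' := (Y, 0)) hle rfl
  obtain ⟨γ, h7, h8⟩ := exists_continuation (monoRule_le_count B fun _ => 1)
    (particleRule_le_count B fun _ => 1) (monoRule_le_count B fun _ => 1)
    (particleRule_le_count B fun _ => 1) h5 hβ
    (fun x hx => absurd (hβ' x hx.1) (not_le.2 hx.2))
  -- The filtered `α₁` fills the block and extends to the final state of `β` by firings at sites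
  -- with two particles, which never empty a site.
  have h9 : ∀ x ∈ B, 1 ≤ ((fireList B ρ (Y, 0) β).1 x).count := by
    rw [← h8]
    refine Admissible.one_le_count (fun _ _ _ h => h.2) (fun y hy => ?_) h7
    refine le_trans ?_ (rank_mono_count (h6 y))
    rw [h4 y hy]; exact hfull y hy
  have hYs : ∀ y, Y y ≠ sleeping := by
    intro y
    by_cases hy : y ∈ B
    · rw [hY y hy]
      have := hX y
      rcases hXy : X y with _ | m
      · exact absurd hXy this
      · rw [iterate_arrive_num]; simp
    · rw [hY' y hy]; simp
  -- Every site of the block ends with at least one particle, at most one, and not asleep.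
  have h10 : (fireList B ρ (Y, 0) β).1 = fullConfig (Finset.Icc l r) := by
    funext x
    by_cases hx : x ∈ B
    · have e1 := h9 x hx
      have e2 := hβ' x hx
      have e3 := hβ.ne_sleeping (fun _ _ h => h.2) hYs x
      rw [fullConfig, if_pos (by simpa [hB] using hx)]
      generalize (fireList B ρ (Y, 0) β).1 x = σ at *
      rcases σ with _ | k
      · exact absurd rfl e3
      · simp only [count] at e1 e2
        congr 1; omega
    · rw [hβ.eq_of_not_mem (fun _ _ h => h.1) hx, fullConfig, if_neg (by simpa [hB] using hx)]
      exact hY' x hx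
  have hst : ∀ x ∈ B, ((fireList B ρ (Y, 0)
      ((α₁ ++ α₂).filter fun x => l ≤ x ∧ x ≤ r)).1 x).IsStable :=
    fun x hx => by rw [h2 x hx]; exact hstable x hx
  -- The exchange lemma again, with the filling rule against legal firing: `β` can be continued
  -- legally to the final state of the filtered list. This continuation stabilizes the full block
  -- with the stacks left by `β`.
  obtain ⟨δ, h11, h12⟩ := exists_continuation (monoRule_le_count B fun _ => 1)
    (particleRule_le_count B fun _ => 1) (monoRule_active B) (particleRule_active B) hβ h1'
    (fun x hx => by
      have := hst x hx.1
      rw [isStable_iff] at this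
      have h' := two_le_count_iff.1 hx.2
      omega)
  set u := (fireList B ρ (Y, 0) β).2 with hu
  have h13 : fireList B ρ (Y, 0) β = (fullConfig (Finset.Icc l r), u + 0) := by
    rw [← h10, add_zero]
  rw [h13] at h11 h12
  rw [fireList_dropStacks] at h12
  rw [admissible_dropStacks] at h11
  have h14 := congrArg Prod.fst h12
  simp only at h14
  have h15 : Stabilizes B (dropStacks u ρ) (fullConfig (Finset.Icc l r)) δ :=
    ⟨legal_iff_admissible.2 h11, fun x hx => by rw [h14]; exact hst x hx⟩
  intro x hx
  rw [stabilization_eq h15, h14]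
  exact h2 x hx

end ARW

/-! ### Random stacks, runs and the strong Markov property. -/

namespace ARW

open SiteState

instance : MeasurableSingletonClass Instr := ⟨fun _ => trivial⟩

instance : MeasurableSingletonClass SiteState := ⟨fun _ => trivial⟩

instance : DiscreteMeasurableSpace Instr := ⟨fun _ => trivial⟩

instance : DiscreteMeasurableSpace SiteState := ⟨fun _ => trivial⟩

instance : Countable Instr :=
  Function.Injective.countable (f := fun i : Instr => match i with
    | .sleep => 0 | .left => 1 | .right => 2) (by intro i j; rcases i <;> rcases j <;> simp)

instance (lam : ℝ≥0∞) : IsProbabilityMeasure (stacksLaw lam) := by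
  unfold stacksLaw; infer_instance

/-- Remove the first instruction from the stack at `x`. -/
def pop (x : ℤ) : Stacks → Stacks := dropStacks (Pi.single x 1)

/-- Add an instruction on top of the stack at `x`. -/
def push (x : ℤ) (p : Instr × Stacks) : Stacks := fun e =>
  if e.1 = x then (if e.2 = 0 then p.1 else p.2 (x, e.2 - 1)) else p.2 e

theorem pop_push (x : ℤ) (p : Instr × Stacks) : (push x p (x, 0), pop x (push x p)) = p := by
  ext1
  · simp [push]
  · funext ⟨y, k⟩
    by_cases h : y = x
    · subst h; simp [pop, push, dropStacks, add_comm 1 k]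
    · simp [pop, push, dropStacks, h]

theorem measurable_pop (x : ℤ) : Measurable (pop x) :=
  measurable_pi_lambda _ fun _ => measurable_pi_apply _

theorem measurable_push (x : ℤ) : Measurable (push x) := by
  refine measurable_pi_lambda _ fun e => ?_
  unfold push
  split_ifs
  · exact measurable_fst
  · exact (measurable_pi_apply _).comp measurable_snd
  · exact (measurable_pi_apply _).comp measurable_snd

/-- The index of an instruction of the popped stacks in the original stacks. -/
def popIndex (x : ℤ) (e : ℤ × ℕ) : ℤ × ℕ := if e.1 = x then (x, e.2 + 1) else e

theorem popIndex_injective (x : ℤ) : Function.Injective (popIndex x) := by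
  rintro ⟨y, k⟩ ⟨z, m⟩ h
  simp only [popIndex] at h
  split_ifs at h <;> simp_all

theorem push_popIndex (x : ℤ) (p : Instr × Stacks) (e : ℤ × ℕ) :
    push x p (popIndex x e) = p.2 e := by
  rcases e with ⟨y, k⟩
  by_cases h : y = x <;> simp [push, popIndex, h]

theorem exists_popIndex {x : ℤ} {e : ℤ × ℕ} (h : e ≠ (x, 0)) : ∃ e', popIndex x e' = e := by
  rcases e with ⟨y, k⟩
  by_cases hy : y = x
  · rcases k with _ | k
    · exact absurd (by rw [hy]) h
    · exact ⟨(x, k), by simp [popIndex, hy]⟩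
  · exact ⟨(y, k), by simp [popIndex, hy]⟩

/-- A product measure is determined by its values on finite boxes, and the preimage of a box is
again a box, with its factors reindexed. -/
theorem map_push (lam : ℝ≥0∞) (x : ℤ) :
    ((instrLaw lam).prod (stacksLaw lam)).map (push x) = stacksLaw lam := by
  classical
  refine Measure.eq_infinitePi _ fun s t ht => ?_
  set s' : Finset (ℤ × ℕ) := s.preimage (popIndex x) (popIndex_injective x).injOn with hs'
  have hpre : push x ⁻¹' Set.pi s t =
      (if (x, 0) ∈ s then t (x, 0) else Set.univ) ×ˢ Set.pi s' fun e => t (popIndex x e) := by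
    ext p
    simp only [Set.mem_preimage, Set.mem_pi, Set.mem_prod, Finset.mem_coe, hs',
      Finset.mem_preimage]
    constructor
    · intro h
      refine ⟨?_, fun e he => by simpa [push_popIndex] using h _ he⟩
      split_ifs with h0
      · simpa [push] using h _ h0
      · trivial
    · rintro ⟨h1, h2⟩ e he
      by_cases h0 : e = (x, 0)
      · subst h0; simpa [push, he] using h1
      · obtain ⟨e', rfl⟩ := exists_popIndex h0
        rw [push_popIndex]; exact h2 _ he
  rw [Measure.map_apply (measurable_push x) (.pi s.countable_toSet fun _ _ => ht _), hpre,
    Measure.prod_prod, stacksLaw, Measure.infinitePi_pi _ fun _ _ => ht _]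
  have h2 : ∏ e ∈ s', instrLaw lam (t (popIndex x e)) =
      ∏ e ∈ s.erase (x, 0), instrLaw lam (t e) := by
    refine Finset.prod_bij (fun e _ => popIndex x e) ?_ ?_ ?_ ?_
    · intro e he
      simp only [hs', Finset.mem_preimage] at he
      refine Finset.mem_erase.2 ⟨?_, he⟩
      rcases e with ⟨y, k⟩
      by_cases h : y = x <;> simp [popIndex, h]
    · intro e _ e' _ h; exact popIndex_injective x h
    · intro e he
      obtain ⟨h1, h2⟩ := Finset.mem_erase.1 he
      obtain ⟨e', rfl⟩ := exists_popIndex h1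
      exact ⟨e', by simpa [hs'] using h2, rfl⟩
    · intro e _; rfl
  rw [h2]
  split_ifs with h0
  · exact Finset.mul_prod_erase s (fun e => instrLaw lam (t e)) h0
  · rw [Finset.erase_eq_of_notMem h0]; simp

theorem measurePreserving_pop (lam : ℝ≥0∞) (x : ℤ) :
    MeasurePreserving (fun ρ : Stacks => (ρ (x, 0), pop x ρ)) (stacksLaw lam)
      ((instrLaw lam).prod (stacksLaw lam)) := by
  have hm : Measurable fun ρ : Stacks => (ρ (x, 0), pop x ρ) :=
    (measurable_pi_apply _).prodMk (measurable_pop x)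
  refine ⟨hm, ?_⟩
  conv_lhs => rw [← map_push lam x]
  rw [Measure.map_map hm (measurable_push x)]
  have : (fun ρ : Stacks => (ρ (x, 0), pop x ρ)) ∘ push x = id := by
    funext p; exact pop_push x p
  rw [this, Measure.map_id]

/-- The probability that an instruction is a step. -/
noncomputable def stepProb (lam : ℝ≥0∞) : ℝ := ((1 + lam)⁻¹).toReal

theorem stepProb_nonneg (lam : ℝ≥0∞) : 0 ≤ stepProb lam := ENNReal.toReal_nonneg

theorem stepProb_le_one (lam : ℝ≥0∞) : stepProb lam ≤ 1 := by
  unfold stepProb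
  refine ENNReal.toReal_le_of_le_ofReal zero_le_one ?_
  rw [ENNReal.ofReal_one]
  exact ENNReal.inv_le_one.2 le_self_add

theorem stepProb_pos {lam : ℝ≥0∞} (h : lam ≠ ∞) : 0 < stepProb lam := by
  refine ENNReal.toReal_pos ?_ ?_
  · exact ENNReal.inv_ne_zero.2 (ENNReal.add_ne_top.2 ⟨by simp, h⟩)
  · exact ENNReal.inv_ne_top.2 (by simp)

/-- The mean of a function of one instruction. -/
noncomputable def instrMean (lam : ℝ≥0∞) (g : Instr → ℝ) : ℝ :=
  (1 - stepProb lam) * g .sleep + stepProb lam / 2 * g .left + stepProb lam / 2 * g .right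

theorem instrMean_mono (lam : ℝ≥0∞) {g h : Instr → ℝ} (hgh : ∀ i, g i ≤ h i) :
    instrMean lam g ≤ instrMean lam h := by
  have h0 := stepProb_nonneg lam
  have h1 := stepProb_le_one lam
  have h2 := mul_le_mul_of_nonneg_left (hgh .sleep) (sub_nonneg.2 h1)
  have h3 := mul_le_mul_of_nonneg_left (hgh .left) (by linarith : (0 : ℝ) ≤ stepProb lam / 2)
  have h4 := mul_le_mul_of_nonneg_left (hgh .right) (by linarith : (0 : ℝ) ≤ stepProb lam / 2)
  unfold instrMean
  linarith

theorem instrMean_mul (lam : ℝ≥0∞) (a : ℝ) (g : Instr → ℝ) :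
    instrMean lam (fun i => a * g i) = a * instrMean lam g := by
  unfold instrMean; ring

/-- One-step analysis: condition on the top instruction at `x`, which is independent of the stacks
below it. All induction on the length of a run goes through this formula. -/
theorem measureReal_pop (lam : ℝ≥0∞) (x : ℤ) {A : Instr → Set Stacks}
    (hA : ∀ i, MeasurableSet (A i)) :
    (stacksLaw lam).real {ρ | pop x ρ ∈ A (ρ (x, 0))} =
      instrMean lam fun i => (stacksLaw lam).real (A i) := by
  have hS : MeasurableSet {p : Instr × Stacks | p.2 ∈ A p.1} := by
    have : {p : Instr × Stacks | p.2 ∈ A p.1} = ⋃ i, {i} ×ˢ A i := by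
      ext p; simp
    rw [this]
    exact MeasurableSet.iUnion fun i => (measurableSet_singleton i).prod (hA i)
  have h1 := (measurePreserving_pop lam x).measure_preimage hS.nullMeasurableSet
  have h2 : (stacksLaw lam) {ρ | pop x ρ ∈ A (ρ (x, 0))} =
      ∫⁻ i, stacksLaw lam (A i) ∂(instrLaw lam) := by
    rw [Measure.prod_apply hS] at h1
    exact h1
  have e1 : (1 - (1 + lam)⁻¹).toReal = 1 - stepProb lam := by
    rw [ENNReal.toReal_sub_of_le (ENNReal.inv_le_one.2 le_self_add) (by simp)]; rfl
  have e2 : ((2 * (1 + lam))⁻¹).toReal = stepProb lam / 2 := by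
    rw [ENNReal.mul_inv (by simp) (by simp), ENNReal.toReal_mul, ENNReal.toReal_inv]
    simp [stepProb]; ring
  have n1 : 1 - (1 + lam)⁻¹ ≠ ∞ := ENNReal.sub_ne_top (by simp)
  have n2 : (2 * (1 + lam))⁻¹ ≠ ∞ := ENNReal.inv_ne_top.2 (by simp)
  simp only [instrLaw, lintegral_add_measure, lintegral_smul_measure, lintegral_dirac,
    smul_eq_mul] at h2
  rw [Measure.real, h2, ENNReal.toReal_add, ENNReal.toReal_add, ENNReal.toReal_mul,
    ENNReal.toReal_mul, ENNReal.toReal_mul, e1, e2]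
  · rfl
  all_goals finiteness

open Classical in
/-- A site of `B` that holds more than `κ` particles, if there is one. -/
noncomputable def nextSite (κ : ℤ → ℕ) (B : Finset ℤ) (c : Config) : Option ℤ :=
  if h : ∃ x ∈ B, κ x < (c x).count then some h.choose else none

theorem nextSite_eq_some {κ : ℤ → ℕ} {B : Finset ℤ} {c : Config} {x : ℤ}
    (h : nextSite κ B c = some x) : x ∈ B ∧ κ x < (c x).count := by
  unfold nextSite at h
  split_ifs at h with h'
  rw [← Option.some.inj h]
  exact h'.choose_spec

theorem nextSite_eq_none {κ : ℤ → ℕ} {B : Finset ℤ} {c : Config}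
    (h : nextSite κ B c = none) : ∀ x ∈ B, (c x).count ≤ κ x := by
  unfold nextSite at h
  split_ifs at h with h'
  push Not at h'
  exact h'

/-- `T` firings at sites of `B` that hold more than `κ` particles, or fewer if there is no such
site left. The result is the configuration with the remaining stacks. -/
noncomputable def run (D : Set ℤ) (κ : ℤ → ℕ) (B : Finset ℤ) : ℕ → Config → Stacks →
    Config × Stacks
  | 0, c, ρ => (c, ρ)
  | T + 1, c, ρ => match nextSite κ B c with
    | none => (c, ρ)
    | some x => run D κ B T (applyInstr D c x (ρ (x, 0))) (pop x ρ)

variable {D : Set ℤ} {κ : ℤ → ℕ} {B : Finset ℤ}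

theorem run_succ_none {c : Config} (h : nextSite κ B c = none) (T : ℕ) (ρ : Stacks) :
    run D κ B (T + 1) c ρ = (c, ρ) := by
  simp only [run, h]

theorem run_succ_some {c : Config} {x : ℤ} (h : nextSite κ B c = some x) (T : ℕ) (ρ : Stacks) :
    run D κ B (T + 1) c ρ = run D κ B T (applyInstr D c x (ρ (x, 0))) (pop x ρ) := by
  simp only [run, h]

theorem dropStacks_add (u v : ℤ → ℕ) (ρ : Stacks) :
    dropStacks (u + v) ρ = dropStacks v (dropStacks u ρ) := by
  funext e; simp [dropStacks, add_assoc]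

/-- A run is a list of firings. -/
theorem exists_list_run (T : ℕ) (c : Config) (ρ : Stacks) : ∃ β : List ℤ, β.length ≤ T ∧
    Admissible D (fun x σ => x ∈ (B : Set ℤ) ∧ κ x < σ.count) ρ (c, 0) β ∧
    run D κ B T c ρ =
      ((fireList D ρ (c, 0) β).1, dropStacks (fireList D ρ (c, 0) β).2 ρ) := by
  have h0 : ∀ c ρ, ((c, ρ) : Config × Stacks) =
      ((fireList D ρ (c, 0) []).1, dropStacks (fireList D ρ (c, 0) []).2 ρ) := by
    intro c ρ; simp [fireList, dropStacks_zero]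
  induction T generalizing c ρ with
  | zero => exact ⟨[], le_rfl, trivial, h0 c ρ⟩
  | succ T ih =>
    rcases h : nextSite κ B c with _ | x
    · exact ⟨[], Nat.zero_le _, trivial, by rw [run_succ_none h]; exact h0 c ρ⟩
    · obtain ⟨β, h1, h2, h3⟩ := ih (applyInstr D c x (ρ (x, 0))) (pop x ρ)
      have e : fire D ρ x (c, 0) = (applyInstr D c x (ρ (x, 0)), Pi.single x 1 + 0) := by
        ext1
        · rfl
        · funext y
          by_cases hy : y = x
          · subst hy; simp [fire]
          · simp [fire, hy]
      refine ⟨x :: β, by simpa using h1, ⟨by simpa using nextSite_eq_some h, ?_⟩, ?_⟩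
      · rw [e, admissible_dropStacks]; exact h2
      · rw [run_succ_some h, h3, fireList, e, fireList_dropStacks, dropStacks_add]; rfl

theorem measurable_run (T : ℕ) (c : Config) : Measurable (run D κ B T c) := by
  induction T generalizing c with
  | zero => exact measurable_const.prodMk measurable_id
  | succ T ih =>
    rcases h : nextSite κ B c with _ | x
    · have : run D κ B (T + 1) c = fun ρ => (c, ρ) := by
        funext ρ; rw [run_succ_none h]
      rw [this]; exact measurable_const.prodMk measurable_id
    · have : run D κ B (T + 1) c = (fun p : Instr × Stacks =>
          run D κ B T (applyInstr D c x p.1) p.2) ∘ fun ρ => (ρ (x, 0), pop x ρ) := by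
        funext ρ; rw [run_succ_some h]; rfl
      rw [this]
      exact (measurable_from_prod_countable_right fun i => ih (applyInstr D c x i)).comp
        ((measurable_pi_apply _).prodMk (measurable_pop x))

/-- The stacks that remain after a run have the same law as the original ones. -/
theorem measurePreserving_run (lam : ℝ≥0∞) (T : ℕ) (c : Config) :
    MeasurePreserving (fun ρ => (run D κ B T c ρ).2) (stacksLaw lam) (stacksLaw lam) := by
  refine ⟨(measurable_run T c).snd, ?_⟩
  induction T generalizing c with
  | zero => exact Measure.map_id
  | succ T ih =>
    rcases h : nextSite κ B c with _ | x
    · have : (fun ρ => (run D κ B (T + 1) c ρ).2) = id := by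
        funext ρ; rw [run_succ_none h]; rfl
      rw [this, Measure.map_id]
    · ext S hS
      have hA : ∀ i, MeasurableSet ((fun ρ => (run D κ B T (applyInstr D c x i) ρ).2) ⁻¹' S) :=
        fun i => (measurable_run T _).snd hS
      rw [Measure.map_apply (measurable_run _ c).snd hS, ← measureReal_eq_measureReal_iff]
      have e : (fun ρ => (run D κ B (T + 1) c ρ).2) ⁻¹' S = {ρ | pop x ρ ∈
          (fun i => (fun ρ => (run D κ B T (applyInstr D c x i) ρ).2) ⁻¹' S) (ρ (x, 0))} := by
        ext ρ; simp [run_succ_some h]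
      rw [e, measureReal_pop lam x hA]
      -- Since the next site depends on the configuration only, each value of the first instruction
      -- leaves stacks with the original law, and averaging changes nothing.
      have hi : ∀ i, (stacksLaw lam).real
          ((fun ρ => (run D κ B T (applyInstr D c x i) ρ).2) ⁻¹' S) = (stacksLaw lam).real S := by
        intro i
        rw [Measure.real, ← Measure.map_apply (measurable_run _ _).snd hS, ih]; rfl
      simp only [hi, instrMean]; ring

/-- A nonnegative superharmonic function that is at least `1` on an event bounds the probability
that a run ends in the event. -/
theorem measureReal_run_le_of_superharmonic (lam : ℝ≥0∞) {V : Config → ℝ} {E : Config → Prop}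
    (hV0 : ∀ c, 0 ≤ V c) (hE : ∀ c, E c → 1 ≤ V c)
    (hV : ∀ c x, nextSite κ B c = some x →
      instrMean lam (fun i => V (applyInstr D c x i)) ≤ V c)
    (hEm : MeasurableSet {c | E c}) (T : ℕ) (c : Config) :
    (stacksLaw lam).real {ρ | E (run D κ B T c ρ).1} ≤ V c := by
  have h0 : ∀ c, (stacksLaw lam).real {_ρ : Stacks | E c} ≤ V c := by
    intro c
    by_cases h : E c
    · exact measureReal_le_one.trans (hE c h)
    · simpa [h] using hV0 c
  induction T generalizing c with
  | zero => exact h0 c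
  | succ T ih =>
    rcases h : nextSite κ B c with _ | x
    · simpa only [run_succ_none h] using h0 c
    · have e : {ρ | E (run D κ B (T + 1) c ρ).1} = {ρ | pop x ρ ∈
          (fun i => {ρ | E (run D κ B T (applyInstr D c x i) ρ).1}) (ρ (x, 0))} := by
        ext ρ; simp [run_succ_some h]
      have hA : ∀ i, MeasurableSet {ρ | E (run D κ B T (applyInstr D c x i) ρ).1} :=
        fun i => (measurable_run T _).fst hEm
      rw [e, measureReal_pop lam x hA]
      exact (instrMean_mono lam fun i => ih _).trans (hV c x h)

/-- A nonnegative function that decreases on average by `p` at each step bounds the probability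
that a run is not finished. -/
theorem measureReal_run_unfinished_le (lam : ℝ≥0∞) {W : Config → ℝ} {p : ℝ}
    (hp : 0 ≤ p) (hW0 : ∀ c, 0 ≤ W c) (hW : ∀ c x, nextSite κ B c = some x →
      instrMean lam (fun i => W (applyInstr D c x i)) ≤ W c - p)
    (hm : MeasurableSet {c | nextSite κ B c ≠ none}) (T : ℕ) (c : Config) :
    T * p * (stacksLaw lam).real {ρ | nextSite κ B (run D κ B T c ρ).1 ≠ none} ≤ W c := by
  induction T generalizing c with
  | zero => simpa using hW0 c
  | succ T ih =>
    rcases h : nextSite κ B c with _ | x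
    · simpa [run_succ_none h, h] using hW0 c
    · have e : {ρ | nextSite κ B (run D κ B (T + 1) c ρ).1 ≠ none} = {ρ | pop x ρ ∈
          (fun i => {ρ | nextSite κ B (run D κ B T (applyInstr D c x i) ρ).1 ≠ none})
            (ρ (x, 0))} := by
        ext ρ; simp [run_succ_some h]
      have e1 : (stacksLaw lam).real {ρ | nextSite κ B (run D κ B (T + 1) c ρ).1 ≠ none} ≤ 1 :=
        measureReal_le_one
      have e2 : (T * p) * (stacksLaw lam).real
          {ρ | nextSite κ B (run D κ B (T + 1) c ρ).1 ≠ none} ≤ W c - p := by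
        have hA : ∀ i, MeasurableSet
            {ρ | nextSite κ B (run D κ B T (applyInstr D c x i) ρ).1 ≠ none} :=
          fun i => (measurable_run T _).fst hm
        rw [e, measureReal_pop lam x hA, ← instrMean_mul]
        exact (instrMean_mono lam fun i => ih _).trans (hW c x h)
      -- The loss of `p` in the first step dominates `p` times the probability, which is the extra
      -- summand for `T + 1`.
      push_cast
      nlinarith

theorem measurableSet_nextSite : MeasurableSet {c | nextSite κ B c ≠ none} := by
  have : {c | nextSite κ B c ≠ none} = ⋃ x ∈ B, (fun c : Config => c x) ⁻¹' {σ | κ x < σ.count} := by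
    ext c
    simp only [Set.mem_ofPred_eq, Set.mem_iUnion, Set.mem_preimage]
    constructor
    · intro h
      obtain ⟨x, hx⟩ := Option.ne_none_iff_exists'.1 h
      exact ⟨x, (nextSite_eq_some hx).1, (nextSite_eq_some hx).2⟩
    · rintro ⟨x, hx, hx'⟩ h
      exact absurd (nextSite_eq_none h x hx) (not_le.2 hx')
  rw [this]
  exact Finset.measurableSet_biUnion _ fun x _ => measurable_pi_apply x trivial

end ARW

/-! ### Sums over particles: conservation, exit times and the martingale of positions. -/

namespace ARW

open SiteState

variable {D : Set ℤ} {κ : ℤ → ℕ}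

/-- The sum of `f` over the particles in `S`. -/
noncomputable def particleSum (f : ℤ → ℝ) (S : Finset ℤ) (c : Config) : ℝ :=
  ∑ z ∈ S, f z * ((c z).count : ℝ)

theorem measurable_particleSum (f : ℤ → ℝ) (S : Finset ℤ) : Measurable (particleSum f S) := by
  refine Finset.measurable_sum _ fun z _ => ?_
  have : Measurable fun σ : SiteState => f z * (σ.count : ℝ) := measurable_from_top
  exact this.comp (measurable_pi_apply z)

theorem particleSum_sleep (f : ℤ → ℝ) (S : Finset ℤ) (c : Config) (x : ℤ) :
    particleSum f S (applyInstr D c x .sleep) = particleSum f S c := by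
  refine Finset.sum_congr rfl fun z _ => ?_
  rw [applyInstr_apply]
  split_ifs with h1 h2
  · subst h1; simp [act, count_trySleep]
  · simp [Moves] at h2
  · rfl

open Classical in
theorem particleSum_move (f : ℤ → ℝ) (S : Finset ℤ) (c : Config) {x y : ℤ} {i : Instr}
    (hx : x ∈ S) (hc : 1 ≤ (c x).count) (hi : i ≠ .sleep) (hy : ∀ z, Moves i x z ↔ z = y) :
    particleSum f S (applyInstr D c x i) =
      particleSum f S c - f x + (if y ∈ D ∧ y ∈ S then f y else 0) := by
  have hxy : y ≠ x := ((hy y).2 rfl).ne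
  have hact : act i (c x) = (c x).depart := by rcases i with _ | _ | _ <;> simp_all [act]
  have key : ∀ z ∈ S, f z * ((applyInstr D c x i z).count : ℝ) =
      f z * ((c z).count : ℝ) + ((if z = x then -f x else 0) +
        if z = y then (if y ∈ D then f y else 0) else 0) := by
    intro z _
    rw [applyInstr_apply]
    by_cases h1 : z = x
    · subst h1
      rw [if_pos rfl, if_pos rfl, if_neg hxy.symm, hact, count_depart, Nat.cast_sub hc]
      push_cast; ring
    · rw [if_neg h1, if_neg h1, hy]
      by_cases h2 : z = y
      · subst h2
        by_cases h3 : z ∈ D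
        · simp [h3, count_arrive]; ring
        · simp [h3]
      · simp [h2]
  unfold particleSum
  rw [Finset.sum_congr rfl key, Finset.sum_add_distrib, Finset.sum_add_distrib,
    Finset.sum_ite_eq' S x, Finset.sum_ite_eq' S y, if_pos hx]
  split_ifs <;> first | (exfalso; tauto) | ring

theorem moves_left (x z : ℤ) : Moves .left x z ↔ z = x - 1 := by simp [Moves]

theorem moves_right (x z : ℤ) : Moves .right x z ↔ z = x + 1 := by simp [Moves]

/-- The expected exit time of a simple random walk from the interval `[a, b]`. -/
def exitTime (a b z : ℤ) : ℝ := (z - a + 1) * (b + 1 - z)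

theorem exitTime_nonneg {a b z : ℤ} (h : z ∈ Finset.Icc a b) : 0 ≤ exitTime a b z := by
  rw [Finset.mem_Icc] at h
  have h1 : (a : ℝ) ≤ z := by exact_mod_cast h.1
  have h2 : (z : ℝ) ≤ b := by exact_mod_cast h.2
  exact mul_nonneg (by linarith) (by linarith)

theorem particleSum_exitTime_nonneg (a b : ℤ) (c : Config) :
    0 ≤ particleSum (exitTime a b) (Finset.Icc a b) c :=
  Finset.sum_nonneg fun _ hz => mul_nonneg (exitTime_nonneg hz) (Nat.cast_nonneg _)

/-- The weight vanishes just outside `[a, b]`, so the formula is the same whether an exiting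
particle is killed or left there. -/
theorem particleSum_exitTime_left {a b : ℤ} (hD : ∀ x ∈ Finset.Icc a b, x ∈ D) (c : Config)
    {x : ℤ} (hx : x ∈ Finset.Icc a b) (hc : 1 ≤ (c x).count) :
    particleSum (exitTime a b) (Finset.Icc a b) (applyInstr D c x .left) =
      particleSum (exitTime a b) (Finset.Icc a b) c - exitTime a b x + exitTime a b (x - 1) := by
  classical
  rw [particleSum_move _ _ _ hx hc (by simp) (moves_left x)]
  split_ifs with h
  · rfl
  · have h1 : x - 1 ∉ Finset.Icc a b := fun h' => h ⟨hD _ h', h'⟩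
    rw [Finset.mem_Icc] at hx h1
    have : x = a := by omega
    subst this; simp [exitTime]

theorem particleSum_exitTime_right {a b : ℤ} (hD : ∀ x ∈ Finset.Icc a b, x ∈ D) (c : Config)
    {x : ℤ} (hx : x ∈ Finset.Icc a b) (hc : 1 ≤ (c x).count) :
    particleSum (exitTime a b) (Finset.Icc a b) (applyInstr D c x .right) =
      particleSum (exitTime a b) (Finset.Icc a b) c - exitTime a b x + exitTime a b (x + 1) := by
  classical
  rw [particleSum_move _ _ _ hx hc (by simp) (moves_right x)]
  split_ifs with h
  · rfl
  · have h1 : x + 1 ∉ Finset.Icc a b := fun h' => h ⟨hD _ h', h'⟩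
    rw [Finset.mem_Icc] at hx h1
    have : x = b := by omega
    subst this; simp [exitTime]

/-- A step lowers the total expected exit time by `1` on average, and an instruction is a step with
probability `stepProb lam`. -/
theorem mul_measureReal_run_unfinished_le (lam : ℝ≥0∞) {a b : ℤ}
    (hD : ∀ x ∈ Finset.Icc a b, x ∈ D) (T : ℕ) (c : Config) :
    T * stepProb lam * (stacksLaw lam).real
      {ρ | nextSite κ (Finset.Icc a b) (run D κ (Finset.Icc a b) T c ρ).1 ≠ none} ≤
      particleSum (exitTime a b) (Finset.Icc a b) c := by
  refine measureReal_run_unfinished_le lam (stepProb_nonneg lam)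
    (particleSum_exitTime_nonneg a b) (fun c x h => ?_) measurableSet_nextSite T c
  obtain ⟨hx, hc⟩ := nextSite_eq_some h
  have hc' : 1 ≤ (c x).count := Nat.one_le_of_lt hc
  simp only [instrMean]
  rw [particleSum_sleep, particleSum_exitTime_left hD c hx hc',
    particleSum_exitTime_right hD c hx hc']
  refine le_of_eq ?_
  simp only [exitTime]; push_cast; ring

/-- Chebyshev's inequality for a martingale whose total variance is controlled by the expected
number of steps, that is, by the exit times. -/
theorem measureReal_run_particleSum_le (lam : ℝ≥0∞) {a b : ℤ} {A : ℝ} (hA : 0 < A) (T : ℕ)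
    (c : Config) :
    (stacksLaw lam).real {ρ | A ≤ |particleSum (fun z => (z : ℝ)) (Finset.Icc (a - 1) (b + 1))
      (run Set.univ κ (Finset.Icc a b) T c ρ).1|} ≤
      (particleSum (fun z => (z : ℝ)) (Finset.Icc (a - 1) (b + 1)) c ^ 2 +
        particleSum (exitTime a b) (Finset.Icc a b) c) / A ^ 2 := by
  refine measureReal_run_le_of_superharmonic lam (E := fun c => A ≤ |particleSum (fun z => (z : ℝ))
      (Finset.Icc (a - 1) (b + 1)) c|)
      (V := fun c => (particleSum (fun z => (z : ℝ)) (Finset.Icc (a - 1) (b + 1)) c ^ 2 +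
        particleSum (exitTime a b) (Finset.Icc a b) c) / A ^ 2) (fun c => ?_) (fun c hc => ?_)
      (fun c x h => ?_) ?_ T c
  · have := particleSum_exitTime_nonneg a b c
    positivity
  · have h1 := particleSum_exitTime_nonneg a b c
    have h2 : A ^ 2 ≤ particleSum (fun z => (z : ℝ)) (Finset.Icc (a - 1) (b + 1)) c ^ 2 := by
      rw [← sq_abs (particleSum _ _ c)]
      exact pow_le_pow_left₀ hA.le hc 2
    rw [le_div_iff₀ (by positivity)]; linarith
  · obtain ⟨hx, hc⟩ := nextSite_eq_some h
    have hc' : 1 ≤ (c x).count := Nat.one_le_of_lt hc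
    have hx' := Finset.mem_Icc.1 hx
    have hxJ : x ∈ Finset.Icc (a - 1) (b + 1) := Finset.mem_Icc.2 (by omega)
    classical
    simp only [instrMean]
    rw [particleSum_sleep, particleSum_sleep,
      particleSum_exitTime_left (fun _ _ => Set.mem_univ _) c hx hc',
      particleSum_exitTime_right (fun _ _ => Set.mem_univ _) c hx hc',
      particleSum_move _ _ c hxJ hc' (by simp) (moves_left x),
      particleSum_move _ _ c hxJ hc' (by simp) (moves_right x),
      if_pos ⟨Set.mem_univ _, Finset.mem_Icc.2 (by omega)⟩,
      if_pos ⟨Set.mem_univ _, Finset.mem_Icc.2 (by omega)⟩]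
    -- The square of the position sum gains `stepProb lam` on average, exactly what the exit time
    -- loses.
    refine le_of_eq ?_
    simp only [exitTime]; push_cast; ring
  · exact measurableSet_le measurable_const (measurable_particleSum _ _).abs

/-- Firings inside `[a, b]` without killing do not change the number of particles in
`[a - 1, b + 1]`. -/
theorem particleSum_fireList_univ {P : ℤ → SiteState → Prop} {ρ : Stacks} {a b : ℤ}
    (hP : ParticleRule P) (hI : ∀ x σ, P x σ → x ∈ Finset.Icc a b) {s : State} {α : List ℤ}
    (hα : Admissible Set.univ P ρ s α) :
    particleSum (fun _ => 1) (Finset.Icc (a - 1) (b + 1)) (fireList Set.univ ρ s α).1 =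
      particleSum (fun _ => 1) (Finset.Icc (a - 1) (b + 1)) s.1 := by
  classical
  induction α generalizing s with
  | nil => rfl
  | cons x α ih =>
    have hx := Finset.mem_Icc.1 (hI _ _ hα.1)
    have hc := hP _ _ hα.1
    have hxJ : x ∈ Finset.Icc (a - 1) (b + 1) := Finset.mem_Icc.2 (by omega)
    rw [fireList, ih hα.2]
    simp only [fire]
    rcases h : ρ (x, s.2 x) with _ | _ | _
    · exact particleSum_sleep _ _ _ _
    · rw [particleSum_move _ _ _ hxJ hc (by simp) (moves_left x),
        if_pos ⟨Set.mem_univ _, Finset.mem_Icc.2 (by omega)⟩]; ring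
    · rw [particleSum_move _ _ _ hxJ hc (by simp) (moves_right x),
        if_pos ⟨Set.mem_univ _, Finset.mem_Icc.2 (by omega)⟩]; ring

/-- The number of particles does not increase. -/
theorem sum_count_fireList_le {ρ : Stacks} {I : Finset ℤ} {P : ℤ → SiteState → Prop}
    (hP : ParticleRule P) (hI : ∀ x σ, P x σ → x ∈ I) {s : State} {α : List ℤ}
    (hα : Admissible (I : Set ℤ) P ρ s α) :
    particleSum (fun _ => 1) I (fireList (I : Set ℤ) ρ s α).1 ≤ particleSum (fun _ => 1) I s.1 := by
  classical
  induction α generalizing s with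
  | nil => exact le_rfl
  | cons x α ih =>
    have hx := hI _ _ hα.1
    have hc := hP _ _ hα.1
    rw [fireList]
    refine (ih hα.2).trans ?_
    simp only [fire]
    rcases h : ρ (x, s.2 x) with _ | _ | _
    · exact (particleSum_sleep _ _ _ _).le
    · rw [particleSum_move _ _ _ hx hc (by simp) (moves_left x)]
      split_ifs <;> linarith
    · rw [particleSum_move _ _ _ hx hc (by simp) (moves_right x)]
      split_ifs <;> linarith

theorem survivors_le_card (I : Finset ℤ) (ρ : Stacks) : survivors I ρ ≤ I.card := by
  have h0 : particleSum (fun _ => 1) I (fullConfig I) = I.card := by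
    unfold particleSum
    rw [Finset.sum_congr rfl (g := fun _ => (1 : ℝ))]
    · simp
    · intro x hx; simp [fullConfig, hx, count]
  have h1 : (survivors I ρ : ℝ) =
      particleSum (fun _ => 1) I (stabilization (I : Set ℤ) ρ (fullConfig I)) := by
    simp [survivors, particleSum]
  have h2 : (survivors I ρ : ℝ) ≤ I.card := by
    rw [h1, ← h0]
    unfold stabilization
    split_ifs with h
    · exact sum_count_fireList_le (particleRule_active _) (fun x σ h => by simpa using h.1)
        (legal_iff_admissible.1 h.choose_spec.1)
    · exact le_rfl
  exact_mod_cast h2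

end ARW

/-! ### The Bernoulli configuration, translation invariance and moments of the odometer. -/

namespace ARW

open SiteState

instance (ζ : unitInterval) : IsProbabilityMeasure (bernoulliConfigLaw ζ) := by
  unfold bernoulliConfigLaw; infer_instance

theorem map_eval_bernoulliConfigLaw (ζ : unitInterval) (x : ℤ) :
    MeasurePreserving (fun η : Config => η x) (bernoulliConfigLaw ζ)
      (ProbabilityTheory.bernoulliMeasure (num 1) (num 0) ζ) :=
  measurePreserving_eval_infinitePi _ x

theorem ae_bernoulliConfigLaw (ζ : unitInterval) :
    ∀ᵐ η ∂bernoulliConfigLaw ζ, ∀ x, η x = num 0 ∨ η x = num 1 := by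
  rw [ae_all_iff]
  intro x
  have h := (map_eval_bernoulliConfigLaw ζ x).measure_preimage
    (s := {σ | ¬ (σ = num 0 ∨ σ = num 1)}) (MeasurableSet.of_discrete).nullMeasurableSet
  rw [ProbabilityTheory.bernoulliMeasure_apply_of_notMem_of_notMem ζ .of_discrete
    (by simp) (by simp)] at h
  exact h

/-- Chebyshev's inequality for weighted sums of the Bernoulli configuration. -/
theorem bernoulliConfigLaw_particleSum_le (ζ : unitInterval) (w : ℤ → ℝ) (S : Finset ℤ) {C A : ℝ}
    (hw : ∀ x ∈ S, |w x| ≤ C) (hA : 0 < A) :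
    bernoulliConfigLaw ζ {η | A ≤ |particleSum w S η - ζ * ∑ x ∈ S, w x|} ≤
      ENNReal.ofReal (S.card * C ^ 2 / A ^ 2) := by
  set X : ℤ → Config → ℝ := fun x η => w x * ((η x).count : ℝ) with hX
  have hg : ∀ x, Measurable fun σ : SiteState => w x * (σ.count : ℝ) := fun x => measurable_from_top
  have hXm : ∀ x, Measurable (X x) := fun x => (hg x).comp (measurable_pi_apply x)
  have hXb : ∀ x ∈ S, ∀ᵐ η ∂bernoulliConfigLaw ζ, X x η ∈ Set.Icc (-C) C := by
    intro x hx
    filter_upwards [ae_bernoulliConfigLaw ζ] with η hη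
    have h1 := hw x hx
    have h2 := abs_le.1 h1
    have h3 := abs_nonneg (w x)
    rcases hη x with h | h <;> simp only [hX, h, count, Set.mem_Icc] <;> push_cast <;>
      constructor <;> linarith
  have hmem : ∀ x ∈ S, MemLp (X x) 2 (bernoulliConfigLaw ζ) := fun x hx =>
    MemLp.of_bound (hXm x).aestronglyMeasurable C <| by
      filter_upwards [hXb x hx] with η hη
      rw [Real.norm_eq_abs]; exact abs_le.2 hη
  have hsum : particleSum w S = ∑ x ∈ S, X x := by
    funext η; simp [particleSum, hX]
  have hmean : ∀ x, ∫ η, X x η ∂bernoulliConfigLaw ζ = ζ * w x := by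
    intro x
    have e : ∫ η, X x η ∂bernoulliConfigLaw ζ =
        ∫ σ, w x * (σ.count : ℝ) ∂((bernoulliConfigLaw ζ).map fun η => η x) := by
      rw [integral_map (measurable_pi_apply x).aemeasurable (hg x).aestronglyMeasurable]
    rw [e, (map_eval_bernoulliConfigLaw ζ x).map_eq,
      ProbabilityTheory.integral_bernoulliMeasure]
    simp [count]
  have hmem' : MemLp (particleSum w S) 2 (bernoulliConfigLaw ζ) := by
    rw [hsum]; exact memLp_finsetSum' S hmem
  have hmean' : ∫ η, particleSum w S η ∂bernoulliConfigLaw ζ = ζ * ∑ x ∈ S, w x := by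
    rw [hsum]
    simp only [Finset.sum_apply]
    rw [integral_finsetSum S fun x hx => (hmem x hx).integrable (by norm_num), Finset.mul_sum]
    exact Finset.sum_congr rfl fun x _ => hmean x
  have hvar : ProbabilityTheory.variance (particleSum w S) (bernoulliConfigLaw ζ) ≤
      S.card * C ^ 2 := by
    rw [hsum, ProbabilityTheory.IndepFun.variance_sum hmem]
    · refine (Finset.sum_le_card_nsmul S _ (C ^ 2) fun x hx => ?_).trans_eq (nsmul_eq_mul _ _)
      refine (ProbabilityTheory.variance_le_sq_of_bounded (hXb x hx)
        (hXm x).aemeasurable).trans_eq ?_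
      ring
    · intro x _ y _ hxy
      exact (ProbabilityTheory.iIndepFun_infinitePi (X := fun x (σ : SiteState) => w x * (σ.count : ℝ)) hg).indepFun
        hxy
  have h := ProbabilityTheory.meas_ge_le_variance_div_sq hmem' hA
  rw [hmean'] at h
  refine h.trans (ENNReal.ofReal_le_ofReal ?_)
  gcongr

theorem measurable_applyInstr {Ω : Type*} [MeasurableSpace Ω] (D : Set ℤ) (x : ℤ) {c : Ω → Config}
    (hc : Measurable c) {i : Ω → Instr} (hi : Measurable i) :
    Measurable fun ω => applyInstr D (c ω) x (i ω) := by
  have : Measurable fun p : Config × Instr => applyInstr D p.1 x p.2 := by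
    refine measurable_from_prod_countable_left fun i => measurable_pi_lambda _ fun z => ?_
    classical
    simp only [applyInstr_apply]
    split_ifs
    · exact (Measurable.of_discrete (f := act i)).comp (measurable_pi_apply x)
    · exact (Measurable.of_discrete (f := arrive)).comp (measurable_pi_apply z)
    · exact measurable_pi_apply z
  exact this.comp (hc.prodMk hi)

theorem measurableSet_legal {Ω : Type*} [MeasurableSpace Ω] (D : Set ℤ) {ρ : Ω → Stacks}
    (hρ : Measurable ρ) {c : Ω → Config} (hc : Measurable c) (u : ℤ → ℕ) (α : List ℤ) :
    MeasurableSet {ω | Legal D (ρ ω) (c ω, u) α} := by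
  induction α generalizing c u with
  | nil => exact MeasurableSet.univ
  | cons x α ih =>
    have h1 : MeasurableSet {ω | ¬ (c ω x).IsStable} :=
      (measurable_pi_iff.1 hc x) (MeasurableSet.of_discrete (s := {σ : SiteState | ¬ σ.IsStable}))
    have h2 := ih (measurable_applyInstr D x hc (measurable_pi_iff.1 hρ (x, u x)))
      (Function.update u x (u x + 1))
    exact (MeasurableSet.const _).inter (h1.inter h2)

/-- The odometer is a supremum over the countable set of finite lists, and legality of a fixed list
is measurable. -/
theorem measurable_odometer (x : ℤ) :
    Measurable fun ω : Stacks × Config => ((odometer ω.1 ω.2 x : ℕ∞) : ℝ≥0∞) := by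
  classical
  have : (fun ω : Stacks × Config => ((odometer ω.1 ω.2 x : ℕ∞) : ℝ≥0∞)) = fun ω =>
      ⨆ α : List ℤ, if Legal Set.univ ω.1 (ω.2, 0) α then ((α.count x : ℕ) : ℝ≥0∞) else 0 := by
    funext ω
    unfold odometer
    rw [ENat.toENNReal_iSup]
    refine iSup_congr fun α => ?_
    by_cases h : Legal Set.univ ω.1 (ω.2, 0) α <;> simp [h]
  rw [this]
  refine Measurable.iSup fun α => Measurable.ite ?_ measurable_const measurable_const
  exact measurableSet_legal _ measurable_fst measurable_snd _ _

/-- The translation of stacks. -/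
def shiftStacks (a : ℤ) (ρ : Stacks) : Stacks := fun e => ρ (e.1 + a, e.2)

/-- The translation of configurations. -/
def shiftConfig (a : ℤ) (η : Config) : Config := fun x => η (x + a)

theorem measurePreserving_shiftStacks (lam : ℝ≥0∞) (a : ℤ) :
    MeasurePreserving (shiftStacks a) (stacksLaw lam) (stacksLaw lam) := by
  refine ⟨measurable_pi_lambda _ fun _ => measurable_pi_apply _, ?_⟩
  exact Measure.map_infinitePi_infinitePi_of_inj (P := fun _ : ℤ × ℕ => instrLaw lam)
    (f := fun e : ℤ × ℕ => (e.1 + a, e.2)) (by rintro ⟨x, k⟩ ⟨y, m⟩ h; simpa using h)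

theorem measurePreserving_shiftConfig (ζ : unitInterval) (a : ℤ) :
    MeasurePreserving (shiftConfig a) (bernoulliConfigLaw ζ) (bernoulliConfigLaw ζ) := by
  refine ⟨measurable_pi_lambda _ fun _ => measurable_pi_apply _, ?_⟩
  exact Measure.map_infinitePi_infinitePi_of_inj
    (P := fun _ : ℤ => ProbabilityTheory.bernoulliMeasure (num 1) (num 0) ζ)
    (f := fun x : ℤ => x + a) (add_left_injective a)

theorem legal_shift (a : ℤ) {ρ : Stacks} {η : Config} {u : ℤ → ℕ} {α : List ℤ} :
    Legal Set.univ (shiftStacks a ρ) (shiftConfig a η, fun x => u (x + a)) α ↔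
      Legal Set.univ ρ (η, u) (α.map (· + a)) := by
  induction α generalizing η u with
  | nil => simp [Legal]
  | cons x α ih =>
    simp only [Legal, List.map_cons, Set.mem_univ, true_and]
    have : fire Set.univ (shiftStacks a ρ) x (shiftConfig a η, fun x => u (x + a)) =
        (shiftConfig a (fire Set.univ ρ (x + a) (η, u)).1,
          fun x' => (fire Set.univ ρ (x + a) (η, u)).2 (x' + a)) := by
      classical
      ext1
      · funext z
        simp only [fire, shiftConfig, shiftStacks]
        rw [applyInstr_apply, applyInstr_apply]
        have e : ∀ i, Moves i (x + a) (z + a) ↔ Moves i x z := by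
          intro i
          simp only [Moves]
          constructor <;> rintro (⟨h1, h2⟩ | ⟨h1, h2⟩)
          · exact Or.inl ⟨h1, by omega⟩
          · exact Or.inr ⟨h1, by omega⟩
          · exact Or.inl ⟨h1, by omega⟩
          · exact Or.inr ⟨h1, by omega⟩
        simp only [e, add_left_inj, Set.mem_univ, true_and]
        rfl
      · funext z
        by_cases hz : z = x
        · subst hz; simp [fire]
        · simp [fire, hz]
    rw [this]
    exact and_congr Iff.rfl ih

theorem odometer_le_shift (ρ : Stacks) (η : Config) (y : ℤ) :
    odometer ρ η y ≤ odometer (shiftStacks y ρ) (shiftConfig y η) 0 := by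
  unfold odometer
  refine iSup₂_le fun α hα => ?_
  have e : (α.map (· + -y)).map (· + y) = α := by simp [Function.comp_def]
  rw [← e] at hα
  have h := (legal_shift y (u := 0)).2 hα
  refine le_trans ?_ (le_iSup₂ (f := fun (α : List ℤ) (_ : Legal Set.univ (shiftStacks y ρ)
    (shiftConfig y η, 0) α) => ((α.count 0 : ℕ) : ℕ∞)) (α.map (· + -y)) h)
  have := List.count_map_of_injective α (· + -y) (add_left_injective (-y)) y
  simp only [add_neg_cancel] at this
  rw [this]

/-- Markov's inequality for the third moment of the odometer. -/
theorem measure_le_odometer (lam : ℝ≥0∞) (ζ : unitInterval) (y : ℤ) {N : ℕ} (hN : 0 < N) :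
    (stacksLaw lam).prod (bernoulliConfigLaw ζ) {ω | (N : ℝ≥0∞) ≤ (odometer ω.1 ω.2 y : ℕ∞)} ≤
      (∫⁻ ω, ((odometer ω.1 ω.2 0 : ℕ∞) : ℝ≥0∞) ^ 3
        ∂((stacksLaw lam).prod (bernoulliConfigLaw ζ))) / (N : ℝ≥0∞) ^ 3 := by
  have hmp := (measurePreserving_shiftStacks lam y).prod (measurePreserving_shiftConfig ζ y)
  have hm : Measurable fun ω : Stacks × Config => ((odometer ω.1 ω.2 0 : ℕ∞) : ℝ≥0∞) ^ 3 :=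
    (measurable_odometer 0).pow_const 3
  rw [← hmp.lintegral_comp hm]
  refine le_trans (measure_mono ?_) (meas_ge_le_lintegral_div
    (hm.comp hmp.measurable).aemeasurable (by positivity) (by finiteness))
  intro ω hω
  have hω' : (N : ℝ≥0∞) ≤ (odometer ω.1 ω.2 y : ℕ∞) := hω
  refine pow_le_pow_left₀ (by positivity) (hω'.trans ?_) 3
  exact ENat.toENNReal_le.2 (odometer_le_shift ω.1 ω.2 y)

/-- A Bernoulli configuration is likely to have a small odometer. -/
theorem bernoulliConfigLaw_odometer_le (lam : ℝ≥0∞) (ζ : unitInterval) (S : Finset ℤ) {N : ℕ}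
    (hN : 0 < N) :
    bernoulliConfigLaw ζ {η | 4⁻¹ ≤
        stacksLaw lam {ρ | ∃ y ∈ S, (N : ℝ≥0∞) ≤ (odometer ρ η y : ℕ∞)}} ≤
      4 * (S.card * ((∫⁻ ω, ((odometer ω.1 ω.2 0 : ℕ∞) : ℝ≥0∞) ^ 3
        ∂((stacksLaw lam).prod (bernoulliConfigLaw ζ))) / (N : ℝ≥0∞) ^ 3)) := by
  set E : Set (Stacks × Config) := {ω | ∃ y ∈ S, (N : ℝ≥0∞) ≤ (odometer ω.1 ω.2 y : ℕ∞)} with hE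
  have hE' : E = ⋃ y ∈ S, {ω | (N : ℝ≥0∞) ≤ (odometer ω.1 ω.2 y : ℕ∞)} := by
    ext ω; simp [hE]
  have hm : MeasurableSet E := by
    rw [hE']
    exact Finset.measurableSet_biUnion _ fun y _ =>
      measurableSet_le measurable_const (measurable_odometer y)
  have h1 : (stacksLaw lam).prod (bernoulliConfigLaw ζ) E ≤
      S.card * ((∫⁻ ω, ((odometer ω.1 ω.2 0 : ℕ∞) : ℝ≥0∞) ^ 3
        ∂((stacksLaw lam).prod (bernoulliConfigLaw ζ))) / (N : ℝ≥0∞) ^ 3) := by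
    rw [hE']
    refine (measure_biUnion_finset_le S _).trans ?_
    refine (Finset.sum_le_card_nsmul S _ _ fun y _ => measure_le_odometer lam ζ y hN).trans_eq ?_
    rw [nsmul_eq_mul]
  rw [Measure.prod_apply_symm hm] at h1
  -- Markov's inequality for the conditional probability given `η`; it turns the joint bound into
  -- one for a fixed configuration.
  have h2 := meas_ge_le_lintegral_div (μ := bernoulliConfigLaw ζ)
    (measurable_measure_prodMk_right (μ := stacksLaw lam) hm).aemeasurable
    (ε := 4⁻¹) (by simp) (by simp)
  refine h2.trans ?_
  rw [ENNReal.div_eq_inv_mul, inv_inv]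
  gcongr

end ARW

/-! ### Carrying the particles of a source to a given configuration. -/

namespace ARW

open SiteState

variable {ρ : Stacks}

/-- `M` active particles at `0` and no particle elsewhere. -/
def sourceConfig (M : ℕ) : Config := fun x => num (if x = 0 then M else 0)

/-- The part of `sourceConfig M` in `[l, r]`, with `k` more particles at `l` and `m` at `r`. -/
def feedConfig (M : ℕ) (l r : ℤ) (k m : ℕ) : Config := fun x =>
  if l ≤ x ∧ x ≤ r then num ((if x = 0 then M else 0) + endArrivals l r k m x) else num 0

theorem eq_zero_of_visited_sourceConfig {M : ℕ} {y : ℤ} (h : Visited (sourceConfig M, 0) y) :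
    y = 0 := by
  by_contra hy
  rcases h with h | h <;> simp [sourceConfig, count, hy] at h

theorem intervalVisited_sourceConfig (M : ℕ) : IntervalVisited (sourceConfig M, 0) :=
  ⟨fun y hy h => absurd (eq_zero_of_visited_sourceConfig h) (by omega),
    fun y hy h => absurd (eq_zero_of_visited_sourceConfig h) (by omega)⟩

theorem particleSum_sourceConfig (M : ℕ) (f : ℤ → ℝ) {S : Finset ℤ} (h : 0 ∈ S) :
    particleSum f S (sourceConfig M) = f 0 * M := by
  unfold particleSum sourceConfig
  rw [Finset.sum_eq_single_of_mem 0 h]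
  · simp [count]
  · intro z _ hz; simp [count, hz]

theorem particleSum_Icc_enlarge (f : ℤ → ℝ) {a b : ℤ} (hab : a ≤ b + 1) (c : Config) :
    particleSum f (Finset.Icc (a - 1) (b + 1)) c = particleSum f (Finset.Icc a b) c +
      f (a - 1) * (c (a - 1)).count + f (b + 1) * (c (b + 1)).count := by
  have h : Finset.Icc (a - 1) (b + 1) = insert (a - 1) (insert (b + 1) (Finset.Icc a b)) := by
    ext z; simp only [Finset.mem_Icc, Finset.mem_insert]; omega
  unfold particleSum
  rw [h, Finset.sum_insert, Finset.sum_insert]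
  · ring
  · simp
  · simp only [Finset.mem_Icc, Finset.mem_insert]; omega

/-- At most `2a` units of mass fit at distance less than `a` from the origin; the rest has weight at
least `a`. -/
theorem mul_sub_le_sum_abs_mul {S : Finset ℤ} {d : ℤ → ℝ} (h0 : ∀ z ∈ S, 0 ≤ d z)
    (h1 : ∀ z ∈ S, d z ≤ 1) (a : ℕ) :
    a * (∑ z ∈ S, d z - 2 * a) ≤ ∑ z ∈ S, |(z : ℝ)| * d z := by
  classical
  have key : ∀ z ∈ S, (a : ℝ) * d z - (if |z| < (a : ℤ) then (a : ℝ) else 0) ≤ |(z : ℝ)| * d z := by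
    intro z hz
    have ha : (0 : ℝ) ≤ a := Nat.cast_nonneg _
    split_ifs with h
    · have := mul_le_mul_of_nonneg_left (h1 z hz) ha
      have := mul_nonneg (abs_nonneg (z : ℝ)) (h0 z hz)
      linarith
    · have : (a : ℝ) ≤ |(z : ℝ)| := by
        push Not at h
        exact_mod_cast h
      have := mul_le_mul_of_nonneg_right this (h0 z hz)
      linarith
  have h2 := Finset.sum_le_sum key
  rw [Finset.sum_sub_distrib, ← Finset.mul_sum, ← Finset.sum_filter, Finset.sum_const,
    nsmul_eq_mul] at h2
  have h3 : ((S.filter fun z => |z| < (a : ℤ)).card : ℝ) ≤ 2 * a := by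
    have : (S.filter fun z => |z| < (a : ℤ)) ⊆ Finset.Ico (-(a : ℤ)) a := by
      intro z hz
      have := abs_lt.1 (Finset.mem_filter.1 hz).2
      exact Finset.mem_Ico.2 (by omega)
    have h4 := Finset.card_le_card this
    rw [Int.card_Ico] at h4
    have h5 : (S.filter fun z => |z| < (a : ℤ)).card ≤ 2 * a := by omega
    exact_mod_cast h5
  have h4 := mul_le_mul_of_nonneg_right h3 (Nat.cast_nonneg (α := ℝ) a)
  nlinarith

theorem one_le_count_of_visited {s : State} {α : List ℤ} {D : Set ℤ} {P : ℤ → SiteState → Prop}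
    (hα : Admissible D P ρ s α) {I : Set ℤ} (hP : ∀ x σ, P x σ → x ∈ I) {y : ℤ} (hy : y ∉ I)
    (hs : s.2 y = 0) (hv : Visited (fireList D ρ s α) y) :
    1 ≤ ((fireList D ρ s α).1 y).count := by
  rcases hv with h | h
  · exact h
  · rw [fireList_odometer, hs, List.count_eq_zero_of_not_mem
      fun h => hy (hα.forall_mem hP y h)] at h
    omega

/-- If the particles of a source are carried to the sites of `η`, then no particle exits from the
interval, provided that `η` has enough particles and is balanced, and that the carried particles
are balanced as well. -/
theorem no_exit_of_carry {n M : ℕ} (hn : 0 < n) {η : Config}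
    (hη : ∀ x, η x = num 0 ∨ η x = num 1) {β : List ℤ}
    (hβ : Admissible Set.univ (fun x σ => x ∈ (Finset.Icc (-(n : ℤ)) (n - 1) : Set ℤ) ∧
      (η x).count < σ.count) ρ (sourceConfig M, 0) β)
    (hend : ∀ x ∈ Finset.Icc (-(n : ℤ)) (n - 1),
      ((fireList Set.univ ρ (sourceConfig M, 0) β).1 x).count ≤ (η x).count)
    {g A A' : ℝ} {a : ℕ} (hg : 0 < g)
    (h1 : M + g ≤ particleSum (fun _ => 1) (Finset.Icc (-(n : ℤ)) (n - 1)) η)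
    (h2 : |particleSum (fun z => (z : ℝ)) (Finset.Icc (-(n : ℤ)) (n - 1)) η| ≤ A)
    (h3 : |particleSum (fun z => (z : ℝ)) (Finset.Icc (-(n : ℤ) - 1) (n - 1 + 1))
      (fireList Set.univ ρ (sourceConfig M, 0) β).1| ≤ A')
    (hA : A + A' < a * (g - 2 * a)) :
    ∀ x ∉ Finset.Icc (-(n : ℤ)) (n - 1),
      ((fireList Set.univ ρ (sourceConfig M, 0) β).1 x).count = 0 := by
  set I := Finset.Icc (-(n : ℤ)) (n - 1) with hI
  set s := fireList Set.univ ρ (sourceConfig M, 0) β with hs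
  have hpart : ParticleRule fun x σ => x ∈ (I : Set ℤ) ∧ (η x).count < σ.count :=
    particleRule_le_count _ _
  have hiv : IntervalVisited s := (intervalVisited_sourceConfig M).fireList hpart hβ
  have hη1 : ∀ x, (η x).count ≤ 1 := by
    intro x; rcases hη x with h | h <;> simp [h, count]
  have hvis : ∀ y, Visited s y → (η y).count ≤ (s.1 y).count :=
    le_count_of_visited (κ := fun x => (η x).count) hη1 (fun _ _ h => h.2)
      (fun y hy => (hη1 y).trans (by
        rcases hy with h | h
        · exact h
        · simp at h)) hβ
  have hcons := particleSum_fireList_univ (a := -(n : ℤ)) (b := n - 1) hpart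
    (fun x σ h => by simpa [hI] using h.1) hβ
  rw [← hs, particleSum_sourceConfig M _ (Finset.mem_Icc.2 (by omega)), one_mul,
    particleSum_Icc_enlarge _ (by omega)] at hcons
  rw [particleSum_Icc_enlarge _ (by omega)] at h3
  simp only [sub_add_cancel] at hcons h3
  rw [← hI] at hcons h3
  set cR := (s.1 (n : ℤ)).count with hcR
  set cL := (s.1 (-(n : ℤ) - 1)).count with hcL
  -- The holes of `η`. They are absent from visited sites, and by conservation their number is at
  -- least `g` plus the number of particles that have left.
  set d : ℤ → ℝ := fun z => ((η z).count : ℝ) - (s.1 z).count with hd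
  have hd0 : ∀ z ∈ I, 0 ≤ d z := fun z hz => by
    have := hend z hz
    simp only [hd, sub_nonneg]; exact_mod_cast this
  have hd1 : ∀ z ∈ I, d z ≤ 1 := fun z _ => by
    have : ((η z).count : ℝ) ≤ 1 := by exact_mod_cast hη1 z
    have := Nat.cast_nonneg (α := ℝ) (s.1 z).count
    simp only [hd]; linarith
  have hdv : ∀ z ∈ I, Visited s z → d z = 0 := fun z hz hv => by
    have := le_antisymm (hvis z hv) (hend z hz)
    simp [hd, this]
  have hsum : ∀ f : ℤ → ℝ, particleSum f I s.1 = particleSum f I η - ∑ z ∈ I, f z * d z := by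
    intro f
    rw [particleSum, particleSum, ← Finset.sum_sub_distrib]
    exact Finset.sum_congr rfl fun z _ => by simp only [hd]; ring
  rw [hsum] at hcons h3
  simp only [one_mul] at hcons
  have hw := mul_sub_le_sum_abs_mul hd0 hd1 a
  have hcR0 : (0 : ℝ) ≤ cR := Nat.cast_nonneg _
  have hcL0 : (0 : ℝ) ≤ cL := Nat.cast_nonneg _
  have hn0 : (0 : ℝ) ≤ n := Nat.cast_nonneg _
  have hnot : ∀ y, y ∉ I → Visited s y → 1 ≤ (s.1 y).count := fun y hy hv =>
    one_le_count_of_visited (I := (I : Set ℤ)) hβ (fun _ _ h => h.1) hy rfl hv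
  have hR : 1 ≤ cR → ∀ z ∈ I, 0 ≤ z → d z = 0 := fun h z hz hz0 =>
    hdv z hz (hiv.of_nonneg_le hz0 (by have := (Finset.mem_Icc.1 hz).2; omega) (Or.inl h))
  have hL : 1 ≤ cL → ∀ z ∈ I, z ≤ 0 → d z = 0 := fun h z hz hz0 =>
    hdv z hz (hiv.of_le_nonpos hz0 (by have := (Finset.mem_Icc.1 hz).1; omega) (Or.inl h))
  have hda : (a : ℝ) * (g - 2 * a) ≤ ∑ z ∈ I, |(z : ℝ)| * d z := by
    refine le_trans (mul_le_mul_of_nonneg_left ?_ (Nat.cast_nonneg a)) hw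
    linarith
  have h2' := abs_le.1 h2
  have h3' := abs_le.1 h3
  -- With exits on both sides every site of `I` is visited, so there is no hole, against `g > 0`.
  have hRL : ¬ (1 ≤ cR ∧ 1 ≤ cL) := by
    rintro ⟨r1, r2⟩
    have : ∑ z ∈ I, d z = 0 := Finset.sum_eq_zero fun z hz => by
      rcases le_total 0 z with h | h
      · exact hR r1 z hz h
      · exact hL r2 z hz h
    linarith
  have cR_zero : cR = 0 := by
    by_contra hne
    have r1 : 1 ≤ cR := Nat.one_le_iff_ne_zero.2 hne
    have r2 : cL = 0 := by by_contra h; exact hRL ⟨r1, Nat.one_le_iff_ne_zero.2 h⟩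
    -- An exit on the right leaves holes only at negative sites, so they pull the position sum in
    -- one direction, by at least `a * (g - 2 * a) > A + A'`. The exited particles at `n` add to
    -- this with the same sign.
    have e : ∑ z ∈ I, (z : ℝ) * d z = - ∑ z ∈ I, |(z : ℝ)| * d z := by
      rw [← Finset.sum_neg_distrib]
      refine Finset.sum_congr rfl fun z hz => ?_
      rcases le_total 0 z with h | h
      · simp [hR r1 z hz h]
      · rw [abs_of_nonpos (by exact_mod_cast h)]; ring
    rw [e, r2] at h3'
    push_cast at h3'
    nlinarith [mul_nonneg hn0 hcR0]
  have cL_zero : cL = 0 := by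
    by_contra hne
    have r1 : 1 ≤ cL := Nat.one_le_iff_ne_zero.2 hne
    have e : ∑ z ∈ I, (z : ℝ) * d z = ∑ z ∈ I, |(z : ℝ)| * d z := by
      refine Finset.sum_congr rfl fun z hz => ?_
      rcases le_total z 0 with h | h
      · simp [hL r1 z hz h]
      · rw [abs_of_nonneg (by exact_mod_cast h)]
    rw [e, cR_zero] at h3'
    push_cast at h3'
    nlinarith [mul_nonneg hn0 hcL0]
  intro x hx
  by_contra hne
  have hv : Visited s x := Or.inl (Nat.one_le_iff_ne_zero.2 hne)
  have hx' : ¬ (-(n : ℤ) ≤ x ∧ x ≤ n - 1) := by rwa [hI, Finset.mem_Icc] at hx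
  -- A particle anywhere outside `I` makes the adjacent outer site visited. That site is never
  -- fired, so it holds a particle, contrary to `cL = 0` or `cR = 0`.
  rcases lt_or_ge x (-(n : ℤ)) with h | h
  · have := hnot (-(n : ℤ) - 1) (by rw [hI, Finset.mem_Icc]; omega)
      (hiv.of_le_nonpos (z := x) (by omega) (by omega) hv)
    omega
  · have := hnot (n : ℤ) (by rw [hI, Finset.mem_Icc]; omega)
      (hiv.of_nonneg_le (z := x) (by omega) (by omega) hv)
    omega

/-- Each particle that arrives costs a firing at a neighbour; this bounds the exits by the odometer.
-/
theorem count_fireList_le (D : Set ℤ) (s : State) (α : List ℤ) (z : ℤ) :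
    ((fireList D ρ s α).1 z).count ≤ (s.1 z).count + α.count (z - 1) + α.count (z + 1) := by
  classical
  induction α generalizing s with
  | nil => simp [fireList]
  | cons x α ih =>
    refine (ih _).trans ?_
    have h : ((fire D ρ x s).1 z).count ≤ (s.1 z).count + (if x = z - 1 then 1 else 0) +
        (if x = z + 1 then 1 else 0) := by
      simp only [fire]
      rw [applyInstr_apply]
      by_cases h1 : z = x
      · subst h1
        rw [if_pos rfl]
        have := count_act_le (ρ (z, s.2 z)) (s.1 z)
        omega
      · rw [if_neg h1]
        by_cases h2 : z ∈ D ∧ Moves (ρ (x, s.2 x)) x z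
        · rw [if_pos h2, count_arrive]
          rcases h2.2 with ⟨_, h3⟩ | ⟨_, h3⟩ <;> split_ifs <;> omega
        · rw [if_neg h2]; omega
    simp only [List.count_cons, beq_iff_eq]
    omega

/-- After the particles have been carried to sites of `η`, the interval is stabilized in at most as
many firings per site as `η` needs on `ℤ`. -/
theorem exists_stabilizing {I : Finset ℤ} {c η : Config} (hc : ∀ x, (c x).rank ≤ (η x).rank) {N : ℕ}
    (hN : ∀ y ∈ I, odometer ρ η y < N) :
    ∃ β, Admissible Set.univ (fun x σ => x ∈ (I : Set ℤ) ∧ ¬ σ.IsStable) ρ (c, 0) β ∧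
      (∀ x ∈ I, ((fireList Set.univ ρ (c, 0) β).1 x).IsStable) ∧ ∀ x, β.count x ≤ N := by
  have hcount : ∀ α, Admissible Set.univ (fun x σ => x ∈ (I : Set ℤ) ∧ ¬ σ.IsStable) ρ (c, 0) α →
      ∀ y, α.count y ≤ N := by
    intro α hα y
    by_cases hy : y ∈ I
    · obtain ⟨h1, -⟩ := hα.mono (monoRule_active _) (s := (c, 0)) (s' := (η, 0)) hc rfl
      have h2 : Legal Set.univ ρ (η, 0) α :=
        legal_iff_admissible.2 (h1.imp fun x σ h => ⟨Set.mem_univ _, h.2⟩)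
      have h3 : ((α.count y : ℕ) : ℕ∞) ≤ odometer ρ η y :=
        le_iSup₂ (f := fun (α : List ℤ) (_ : Legal Set.univ ρ (η, 0) α) =>
          ((α.count y : ℕ) : ℕ∞)) α h2
      exact_mod_cast (h3.trans_lt (hN y hy)).le
    · rw [List.count_eq_zero_of_not_mem fun h => hy (hα.forall_mem (S := (I : Set ℤ))
        (fun _ _ h => h.1) y h)]
      exact Nat.zero_le _
  obtain ⟨β, hβ, hmax⟩ := exists_maximal_list
    (p := fun α => Admissible Set.univ (fun x σ => x ∈ (I : Set ℤ) ∧ ¬ σ.IsStable) ρ (c, 0) α)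
    trivial (∑ _x ∈ I, N) (fun α hα => (length_le_sum_count I fun x hx => by
      simpa using hα.forall_mem (S := (I : Set ℤ)) (fun _ _ h => h.1) x hx).trans
        (Finset.sum_le_sum fun x _ => hcount α hα x))
  refine ⟨β, hβ, fun x hx => ?_, hcount β hβ⟩
  by_contra h
  exact hmax x (admissible_append.2 ⟨hβ, ⟨by simpa using hx, h⟩, trivial⟩)

end ARW

/-! ### Cautious firing and the particle count by blocks. -/

namespace ARW

open SiteState

variable {ρ : Stacks}

/-- The site `x` of `I` holds an active particle, and it holds at least two particles or all sites
of its block of `b` sites have been visited. -/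
def Firable (b : ℕ) (I : Finset ℤ) (s : State) (x : ℤ) : Prop :=
  (x ∈ (I : Set ℤ) ∧ ¬ (s.1 x).IsStable) ∧
    (2 ≤ (s.1 x).count ∨ ∀ y : ℤ, y / b = x / b → Visited s y)

/-- All firings of the list take place at firable sites. -/
def Cautious (b : ℕ) (I : Finset ℤ) (ρ : Stacks) (s : State) : List ℤ → Prop
  | [] => True
  | x :: α => Firable b I s x ∧ Cautious b I ρ (fire Set.univ ρ x s) α

theorem cautious_append_singleton {b : ℕ} {I : Finset ℤ} {s : State} {α : List ℤ} {x : ℤ} :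
    Cautious b I ρ s (α ++ [x]) ↔
      Cautious b I ρ s α ∧ Firable b I (fireList Set.univ ρ s α) x := by
  induction α generalizing s with
  | nil => simp [Cautious, fireList]
  | cons y α ih => simp [Cautious, fireList, ih, and_assoc]

theorem Cautious.admissible {b : ℕ} {I : Finset ℤ} {s : State} {α : List ℤ}
    (h : Cautious b I ρ s α) :
    Admissible Set.univ (fun x σ => x ∈ (I : Set ℤ) ∧ ¬ σ.IsStable) ρ s α := by
  induction α generalizing s with
  | nil => trivial
  | cons x α ih => exact ⟨h.1.1, ih h.2⟩

theorem mem_block_iff {b : ℕ} (hb : 0 < b) {y q : ℤ} :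
    y ∈ Set.Icc (b * q) (b * q + b - 1) ↔ y / b = q := by
  have hb' : (0 : ℤ) < b := by exact_mod_cast hb
  rw [Set.mem_Icc]
  constructor
  · rintro ⟨h1, h2⟩
    refine le_antisymm ?_ ?_
    · refine Int.lt_add_one_iff.1 (Int.ediv_lt_of_lt_mul hb' ?_)
      nlinarith
    · exact (Int.le_ediv_iff_mul_le hb').2 (by nlinarith)
  · rintro rfl
    have h1 := Int.emod_nonneg y hb'.ne'
    have h2 := Int.emod_lt_of_pos y hb'
    have h3 := Int.mul_ediv_add_emod y b
    constructor <;> linarith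

/-- The block `q` of a cautious list is fired only at sites with at least two particles until it is
full, if it becomes full. -/
theorem Cautious.exists_split {b : ℕ} (hb : 0 < b) {I : Finset ℤ} {M : ℕ} {q : ℤ} {α : List ℤ}
    (hα : Cautious b I ρ (sourceConfig M, 0) α) : ∃ α₁ α₂, α = α₁ ++ α₂ ∧
      Admissible Set.univ (fun x σ => (x ∈ (I : Set ℤ) ∧ ¬ σ.IsStable) ∧
        (x ∈ Set.Icc (b * q) (b * q + b - 1) → 2 ≤ σ.count)) ρ (sourceConfig M, 0) α₁ ∧
      ((∀ y, y / b = q → Visited (fireList Set.univ ρ (sourceConfig M, 0) α) y) →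
        ∀ y ∈ Set.Icc (b * q) (b * q + b - 1),
          1 ≤ ((fireList Set.univ ρ (sourceConfig M, 0) α₁).1 y).count) := by
  classical
  have hvis : ∀ α, Admissible Set.univ (fun x σ => (x ∈ (I : Set ℤ) ∧ ¬ σ.IsStable) ∧
      (x ∈ Set.Icc (b * q) (b * q + b - 1) → 2 ≤ σ.count)) ρ (sourceConfig M, 0) α →
      (∀ y, y / b = q → Visited (fireList Set.univ ρ (sourceConfig M, 0) α) y) →
      ∀ y ∈ Set.Icc (b * q) (b * q + b - 1),
          1 ≤ ((fireList Set.univ ρ (sourceConfig M, 0) α).1 y).count := by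
    intro α hα hv y hy
    have h := le_count_of_visited (D := Set.univ)
      (κ := fun x => if x ∈ Set.Icc (b * q) (b * q + b - 1) then 1 else 0)
      (fun x => by split_ifs <;> omega) (fun x σ h => ?_) (fun z hz => ?_) hα y
      (hv y ((mem_block_iff hb).1 hy))
    · simpa [hy] using h
    · have := particleRule_active (I : Set ℤ) x σ h.1
      split_ifs with hx
      · exact h.2 hx
      · omega
    · rcases hz with h | h
      · split_ifs <;> omega
      · simp at h
  suffices h : ∃ α₁ α₂, α = α₁ ++ α₂ ∧
      Admissible Set.univ (fun x σ => (x ∈ (I : Set ℤ) ∧ ¬ σ.IsStable) ∧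
        (x ∈ Set.Icc (b * q) (b * q + b - 1) → 2 ≤ σ.count)) ρ (sourceConfig M, 0) α₁ ∧
      (α₂ = [] ∨ ∀ y ∈ Set.Icc (b * q) (b * q + b - 1),
          1 ≤ ((fireList Set.univ ρ (sourceConfig M, 0) α₁).1 y).count) by
    obtain ⟨α₁, α₂, h1, h2, h3⟩ := h
    refine ⟨α₁, α₂, h1, h2, fun hv => ?_⟩
    rcases h3 with rfl | h3
    · rw [List.append_nil] at h1
      subst h1
      exact hvis _ h2 hv
    · exact h3
  induction α using List.reverseRecOn with
  | nil => exact ⟨[], [], rfl, trivial, Or.inl rfl⟩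
  | append_singleton α x ih =>
    rw [cautious_append_singleton] at hα
    obtain ⟨α₁, α₂, h1, h2, h3⟩ := ih hα.1
    rcases h3 with rfl | h3
    · rw [List.append_nil] at h1
      subst h1
      by_cases hx : x ∈ Set.Icc (b * q) (b * q + b - 1) →
          2 ≤ ((fireList Set.univ ρ (sourceConfig M, 0) α).1 x).count
      · exact ⟨α ++ [x], [], by simp, admissible_append.2 ⟨h2, ⟨hα.2.1, hx⟩, trivial⟩, Or.inl rfl⟩
      -- This is the first firing of a lone particle of the block. By caution the block is fully
      -- visited, and as only sites with two particles were fired in it so far, it is full.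
      · push Not at hx
        refine ⟨α, [x], rfl, h2, Or.inr (hvis α h2 ?_)⟩
        have hx' := (mem_block_iff hb).1 hx.1
        rcases hα.2.2 with h | h
        · omega
        · rwa [hx'] at h
    · exact ⟨α₁, α₂ ++ [x], by rw [h1, List.append_assoc], h2, Or.inr h3⟩

/-- The deterministic core of the comparison of the two densities: if the particles of a source
can be stabilized inside an interval with few exits, and if blocks, once filled, keep few
particles, then the source has few particles. -/
theorem card_source_le {b K M : ℕ} (hb : 0 < b) {β : List ℤ} {E N : ℕ} {t : ℝ} (ht : 0 ≤ t)
    (hβ : Admissible Set.univ (fun x σ => x ∈ (Finset.Ico (-(b * K : ℤ)) (b * K) : Set ℤ) ∧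
      0 < σ.count) ρ (sourceConfig M, 0) β)
    (hend : ∀ x ∈ Finset.Ico (-(b * K : ℤ)) (b * K),
      ((fireList Set.univ ρ (sourceConfig M, 0) β).1 x).IsStable)
    (hexit : ∀ x ∉ Finset.Ico (-(b * K : ℤ)) (b * K),
      ((fireList Set.univ ρ (sourceConfig M, 0) β).1 x).count ≤ E)
    (hN : ∀ x, β.count x ≤ N) (hK : 0 < K)
    (hblock : ∀ q ∈ Finset.Ico (-(K : ℤ)) K, ∀ k ≤ N, ∀ m ≤ N, ∃ γ,
      Admissible (Set.Icc (b * q) (b * q + b - 1))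
        (fun x σ => x ∈ Set.Icc (b * q) (b * q + b - 1) ∧ 1 < σ.count) ρ
        (feedConfig M (b * q) (b * q + b - 1) k m, 0) γ ∧
      (∀ x ∈ Set.Icc (b * q) (b * q + b - 1), ((fireList (Set.Icc (b * q) (b * q + b - 1)) ρ
        (feedConfig M (b * q) (b * q + b - 1) k m, 0) γ).1 x).count ≤ 1) ∧
      (survivors (Finset.Icc (b * q) (b * q + b - 1)) (dropStacks (fireList
        (Set.Icc (b * q) (b * q + b - 1)) ρ
        (feedConfig M (b * q) (b * q + b - 1) k m, 0) γ).2 ρ) : ℝ) ≤ t) :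
    (M : ℝ) ≤ 2 * K * t + 2 * b + 2 * E := by
  classical
  have hb' : (0 : ℤ) < b := by exact_mod_cast hb
  have hbK : (0 : ℤ) < b * K := mul_pos hb' (by exact_mod_cast hK)
  set I := Finset.Ico (-(b * K : ℤ)) (b * K) with hI
  have hmemI : ∀ x, x ∈ I ↔ x / b ∈ Finset.Ico (-(K : ℤ)) K := by
    intro x
    rw [hI, Finset.mem_Ico, Finset.mem_Ico, Int.le_ediv_iff_mul_le hb', Int.ediv_lt_iff_lt_mul hb']
    constructor <;> rintro ⟨h1, h2⟩ <;> constructor <;> linarith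
  -- the exchange of cautious lists with `β`
  have hexch : ∀ α, Cautious b I ρ (sourceConfig M, 0) α → ∃ γ,
      Admissible Set.univ (fun x σ => x ∈ (I : Set ℤ) ∧ 0 < σ.count) ρ
        (fireList Set.univ ρ (sourceConfig M, 0) α) γ ∧
      fireList Set.univ ρ (fireList Set.univ ρ (sourceConfig M, 0) α) γ =
        fireList Set.univ ρ (sourceConfig M, 0) β := fun α hα =>
    exists_continuation (monoRule_active _) (particleRule_active _)
      (monoRule_le_count _ fun _ => 0) (particleRule_le_count _ fun _ => 0) hα.admissible hβ
      (fun x hx => hx.2 (hend x (by simpa using hx.1)))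
  have hcount : ∀ α, Cautious b I ρ (sourceConfig M, 0) α → ∀ x, α.count x ≤ N := by
    intro α hα x
    obtain ⟨γ, -, h⟩ := hexch α hα
    exact (count_le_of_exists_continuation h x).trans (hN x)
  obtain ⟨α, hα, hmax⟩ := exists_maximal_list (p := Cautious b I ρ (sourceConfig M, 0)) trivial
    (∑ _x ∈ I, N) (fun α hα => (length_le_sum_count I fun x hx => by
      simpa using hα.admissible.forall_mem (S := (I : Set ℤ)) (fun _ _ h => h.1) x hx).trans
        (Finset.sum_le_sum fun x _ => hcount α hα x))
  obtain ⟨γ, hγ, hγ'⟩ := hexch α hα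
  set s := fireList Set.univ ρ (sourceConfig M, 0) α with hs
  have hfir : ∀ x, ¬ Firable b I s x := fun x hx => hmax x (cautious_append_singleton.2 ⟨hα, hx⟩)
  -- The continuation `γ` never fires outside `I`, so the particles already there remain until the
  -- end of `β`.
  have hexit' : ∀ x ∉ I, (s.1 x).count ≤ E := by
    intro x hx
    refine le_trans (rank_mono_count ?_) (hexit x hx)
    rw [← hγ']
    exact rank_le_fireList s fun h => hx (by
      simpa using hγ.forall_mem (S := (I : Set ℤ)) (fun _ _ h => h.1) x h)
  have hiv : IntervalVisited s :=
    (intervalVisited_sourceConfig M).fireList (particleRule_active _) hα.admissible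
  -- conservation of the number of particles
  have hIcc : I = Finset.Icc (-(b * K : ℤ)) (b * K - 1) := by
    ext x; simp only [hI, Finset.mem_Ico, Finset.mem_Icc]; omega
  have hcons := particleSum_fireList_univ (a := -(b * K : ℤ)) (b := (b * K : ℤ) - 1)
    (particleRule_active (I : Set ℤ))
    (fun x σ h => by rw [← hIcc]; simpa using h.1) hα.admissible
  rw [← hs, particleSum_sourceConfig M _ (Finset.mem_Icc.2 (by omega)), one_mul,
    particleSum_Icc_enlarge _ (by linarith), ← hIcc, one_mul, one_mul] at hcons
  have hE1 : ((s.1 (-((b : ℤ) * K) - 1)).count : ℝ) ≤ E := by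
    exact Nat.cast_le.2 (hexit' _ (by rw [hI, Finset.mem_Ico]; omega))
  have hE2 : ((s.1 ((b : ℤ) * K - 1 + 1)).count : ℝ) ≤ E := by
    exact Nat.cast_le.2 (hexit' _ (by rw [hI, Finset.mem_Ico]; omega))
  -- the blocks
  set bl : ℤ → Finset ℤ := fun q => Finset.Icc (b * q) (b * q + b - 1) with hbl
  have hmem : ∀ q y, y ∈ bl q ↔ y / b = q := fun q y => by
    rw [← mem_block_iff hb, hbl, Finset.mem_Icc, Set.mem_Icc]
  set bad : Finset ℤ := (Finset.Ico (-(K : ℤ)) K).filter fun q =>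
    (∃ y ∈ bl q, ¬ Visited s y) ∧ ∃ y ∈ bl q, Visited s y with hbad
  have hblk : ∀ q ∈ Finset.Ico (-(K : ℤ)) K,
      ∑ x ∈ bl q, ((s.1 x).count : ℝ) ≤ t + if q ∈ bad then (b : ℝ) else 0 := by
    intro q hq
    by_cases hv : ∀ y, y / b = q → Visited s y
    · have hst : ∀ x ∈ Set.Icc (b * q) (b * q + b - 1), (s.1 x).IsStable := by
        intro x hx
        by_contra h
        have hx' := (mem_block_iff hb).1 hx
        refine hfir x ⟨⟨?_, h⟩, Or.inr fun y hy => hv y (hy.trans hx')⟩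
        exact Finset.mem_coe.2 ((hmemI x).2 (hx' ▸ hq))
      obtain ⟨α₁, α₂, rfl, h2, h3⟩ := hα.exists_split hb (q := q)
      -- The numbers of particles entering at the two ends depend on all the stacks, which is why
      -- `hblock` is required for every pair of values up to `N`.
      set k := inflow ρ (b * q - 1) .right 0 (α₁ ++ α₂) with hk
      set m := inflow ρ (b * q + b - 1 + 1) .left 0 (α₁ ++ α₂) with hm
      have hkN : k ≤ N := (inflow_le_count _ _ _ _).trans (hcount _ hα _)
      have hmN : m ≤ N := (inflow_le_count _ _ _ _).trans (hcount _ hα _)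
      obtain ⟨δ, h4, h5, h6⟩ := hblock q hq k hkN m hmN
      have h7 := eq_stabilization_fullConfig (by omega) (X := sourceConfig M)
        (Y := feedConfig M (b * q) (b * q + b - 1) k m) (I := (I : Set ℤ))
        (fun y => by simp [sourceConfig])
        (fun x hx => by
          rw [sourceConfig, iterate_arrive_num, feedConfig]; exact if_pos hx)
        (fun x hx => by rw [feedConfig]; exact if_neg hx) h2 (h3 hv) hα.admissible hst h4 h5
      have h8 : ∑ x ∈ bl q, ((s.1 x).count : ℝ) ≤ t := by
        refine le_trans (le_of_eq ?_) h6
        rw [survivors, Nat.cast_sum]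
        refine Finset.sum_congr rfl fun x hx => ?_
        have := h7 x (by simpa [hbl] using hx)
        rw [hs, ← this, Finset.coe_Icc]
      split_ifs <;> linarith [Nat.cast_nonneg (α := ℝ) b]
    · push Not at hv
      obtain ⟨y, hy, hy'⟩ := hv
      by_cases hne : ∃ y ∈ bl q, Visited s y
      · have hqb : q ∈ bad := Finset.mem_filter.2 ⟨hq, ⟨y, (hmem q y).2 hy, hy'⟩, hne⟩
        rw [if_pos hqb]
        -- A site with two particles would still be firable, against the maximality of `α`.
        have h1 : ∀ x ∈ bl q, ((s.1 x).count : ℝ) ≤ 1 := by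
          intro x hx
          by_contra h
          have h2 : 2 ≤ (s.1 x).count := by
            push Not at h
            exact_mod_cast h
          have h3 := (hmem q x).1 hx
          refine hfir x ⟨⟨Finset.mem_coe.2 ((hmemI x).2 (h3 ▸ hq)), ?_⟩, Or.inl h2⟩
          rw [not_isStable_iff]
          have := two_le_count_iff.1 h2
          omega
        have h2 := Finset.sum_le_card_nsmul (bl q) _ 1 h1
        have h3 : (bl q).card = b := by simp [hbl]
        rw [h3] at h2
        simp at h2
        linarith
      · push Not at hne
        have : ∑ x ∈ bl q, ((s.1 x).count : ℝ) = 0 := by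
          refine Finset.sum_eq_zero fun x hx => ?_
          by_contra h
          exact hne x hx (Or.inl (Nat.one_le_iff_ne_zero.2 (by exact_mod_cast h)))
        rw [this]
        split_ifs <;> linarith [Nat.cast_nonneg (α := ℝ) b]
  -- As the visited sites form an interval around `0`, only its two ends can cut through a block:
  -- one block on each side.
  have hbad_card : bad.card ≤ 2 := by
    have hnn : ∀ q : ℤ, 0 ≤ q → ∀ y ∈ bl q, 0 ≤ y := by
      intro q hq y hy
      have := (Finset.mem_Icc.1 hy).1
      have := mul_nonneg hb'.le hq
      omega
    have hnp : ∀ q : ℤ, ¬ 0 ≤ q → ∀ y ∈ bl q, y ≤ 0 := by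
      intro q hq y hy
      have h1 := (Finset.mem_Icc.1 hy).2
      push Not at hq
      have h2 : (b : ℤ) * (q + 1) ≤ 0 := mul_nonpos_of_nonneg_of_nonpos hb'.le (by omega)
      linarith
    have hsep : ∀ q q' : ℤ, q < q' → ∀ y ∈ bl q, ∀ z ∈ bl q', y ≤ z := by
      intro q q' hqq y hy z hz
      rw [hmem] at hy hz
      by_contra h
      push Not at h
      have := Int.ediv_le_ediv hb' h.le
      omega
    have h1 : (bad.filter fun q => 0 ≤ q).card ≤ 1 := by
      refine Finset.card_le_one.2 ?_
      have : ∀ q ∈ bad.filter (fun q => 0 ≤ q), ∀ q' ∈ bad.filter (fun q => 0 ≤ q), ¬ q < q' := by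
        intro q hq q' hq' hlt
        simp only [hbad, Finset.mem_filter] at hq hq'
        obtain ⟨y, hy, hy'⟩ := hq.1.2.1
        obtain ⟨z, hz, hz'⟩ := hq'.1.2.2
        exact hy' (hiv.of_nonneg_le (hnn q hq.2 y hy) (hsep q q' hlt y hy z hz) hz')
      intro q hq q' hq'
      have h3 := this q hq q' hq'
      have h4 := this q' hq' q hq
      omega
    have h2 : (bad.filter fun q => ¬ 0 ≤ q).card ≤ 1 := by
      refine Finset.card_le_one.2 ?_
      have : ∀ q ∈ bad.filter (fun q => ¬ 0 ≤ q), ∀ q' ∈ bad.filter (fun q => ¬ 0 ≤ q),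
          ¬ q < q' := by
        intro q hq q' hq' hlt
        simp only [hbad, Finset.mem_filter] at hq hq'
        obtain ⟨y, hy, hy'⟩ := hq.1.2.2
        obtain ⟨z, hz, hz'⟩ := hq'.1.2.1
        exact hz' (hiv.of_le_nonpos (hnp q' hq'.2 z hz) (hsep q q' hlt y hy z hz) hy')
      intro q hq q' hq'
      have h3 := this q hq q' hq'
      have h4 := this q' hq' q hq
      omega
    have := Finset.card_filter_add_card_filter_not (s := bad) (fun q => 0 ≤ q)
    omega
  have htot : particleSum (fun _ => 1) I s.1 ≤ 2 * K * t + 2 * b := by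
    have e1 : particleSum (fun _ => 1) I s.1 =
        ∑ q ∈ Finset.Ico (-(K : ℤ)) K, ∑ x ∈ bl q, ((s.1 x).count : ℝ) := by
      unfold particleSum
      rw [← Finset.sum_fiberwise_of_maps_to (g := fun x : ℤ => x / b)
        (t := Finset.Ico (-(K : ℤ)) K) fun x hx => (hmemI x).1 hx]
      refine Finset.sum_congr rfl fun q hq => ?_
      have : (I.filter fun x => x / b = q) = bl q := by
        ext x
        rw [Finset.mem_filter, hmem, hmemI]
        exact ⟨fun h => h.2, fun h => ⟨h ▸ hq, h⟩⟩
      rw [this]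
      simp
    rw [e1]
    refine (Finset.sum_le_sum hblk).trans ?_
    rw [Finset.sum_add_distrib, Finset.sum_const, nsmul_eq_mul, Int.card_Ico,
      ← Finset.sum_filter, Finset.sum_const, nsmul_eq_mul]
    have h1 : (((Finset.Ico (-(K : ℤ)) K).filter fun q => q ∈ bad).card : ℝ) ≤ 2 := by
      have : ((Finset.Ico (-(K : ℤ)) K).filter fun q => q ∈ bad).card ≤ 2 :=
        (Finset.card_le_card fun q hq => (Finset.mem_filter.1 hq).2).trans hbad_card
      exact_mod_cast this
    have h2 : ((((K : ℤ) - -K).toNat : ℕ) : ℝ) = 2 * K := by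
      have : ((K : ℤ) - -K).toNat = 2 * K := by omega
      rw [this]; push_cast; ring
    rw [h2]
    have := mul_le_mul_of_nonneg_right h1 (Nat.cast_nonneg (α := ℝ) b)
    linarith
  linarith

end ARW

/-! ### From the deterministic comparison to a union bound. -/

namespace ARW

open SiteState

/-- The comparison of the two densities for given stacks. -/
theorem card_source_le_of_run {ρ : Stacks} {b K M T N : ℕ} (hb : 0 < b) (hK : 0 < K) {η : Config}
    (hη : ∀ x, η x = num 0 ∨ η x = num 1) {g A A' t : ℝ} {a : ℕ} (hg : 0 < g) (ht : 0 ≤ t)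
    (h1 : M + g ≤ particleSum (fun _ => 1)
      (Finset.Icc (-((b * K : ℕ) : ℤ)) ((b * K : ℕ) - 1)) η)
    (h2 : |particleSum (fun z => (z : ℝ))
      (Finset.Icc (-((b * K : ℕ) : ℤ)) ((b * K : ℕ) - 1)) η| ≤ A)
    (hA : A + A' < a * (g - 2 * a))
    (h3 : nextSite (fun x => (η x).count) (Finset.Icc (-((b * K : ℕ) : ℤ)) ((b * K : ℕ) - 1))
      (run Set.univ (fun x => (η x).count) (Finset.Icc (-((b * K : ℕ) : ℤ)) ((b * K : ℕ) - 1)) T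
        (sourceConfig M) ρ).1 = none)
    (h4 : |particleSum (fun z => (z : ℝ))
      (Finset.Icc (-((b * K : ℕ) : ℤ) - 1) ((b * K : ℕ) - 1 + 1))
      (run Set.univ (fun x => (η x).count) (Finset.Icc (-((b * K : ℕ) : ℤ)) ((b * K : ℕ) - 1)) T
        (sourceConfig M) ρ).1| ≤ A')
    (h5 : ∀ y ∈ Finset.Icc (-((b * K : ℕ) : ℤ)) ((b * K : ℕ) - 1), odometer
      (run Set.univ (fun x => (η x).count) (Finset.Icc (-((b * K : ℕ) : ℤ)) ((b * K : ℕ) - 1)) T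
        (sourceConfig M) ρ).2 η y < N)
    (h6 : ∀ q ∈ Finset.Ico (-(K : ℤ)) K, ∀ k ≤ T + N, ∀ m ≤ T + N, ∃ T',
      nextSite (fun _ => 1) (Finset.Icc (b * q) (b * q + b - 1))
        (run (Set.Icc (b * q) (b * q + b - 1)) (fun _ => 1) (Finset.Icc (b * q) (b * q + b - 1)) T'
          (feedConfig M (b * q) (b * q + b - 1) k m) ρ).1 = none ∧
      (survivors (Finset.Icc (b * q) (b * q + b - 1))
        (run (Set.Icc (b * q) (b * q + b - 1)) (fun _ => 1) (Finset.Icc (b * q) (b * q + b - 1)) T'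
          (feedConfig M (b * q) (b * q + b - 1) k m) ρ).2 : ℝ) ≤ t) :
    (M : ℝ) ≤ 2 * K * t + 2 * b + 4 * N := by
  set n : ℕ := b * K with hn
  have hn0 : 0 < n := Nat.mul_pos hb hK
  set I := Finset.Icc (-(n : ℤ)) (n - 1) with hI
  have hIco : Finset.Ico (-((b : ℤ) * K)) (b * K) = I := by
    ext x
    have : (n : ℤ) = b * K := by rw [hn]; push_cast; ring
    rw [hI, Finset.mem_Ico, Finset.mem_Icc, this]; omega
  obtain ⟨β₁, hlen, hβ₁, hrun⟩ := exists_list_run (D := Set.univ)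
    (κ := fun x => (η x).count) (B := I) T (sourceConfig M) ρ
  rw [hrun] at h3 h4 h5
  simp only at h3 h4 h5
  have hend₁ := nextSite_eq_none h3
  have hexit₁ := no_exit_of_carry hn0 hη hβ₁ hend₁ hg h1 h2 h4 hA
  set s := fireList Set.univ ρ (sourceConfig M, 0) β₁ with hs
  -- Carrying may leave sleepers, but only at sites where `η` has an active particle, and a sleeper
  -- ranks below it.
  have hrank : ∀ x, (s.1 x).rank ≤ (η x).rank := by
    intro x
    have hx : (s.1 x).count ≤ (η x).count := by
      by_cases h : x ∈ I
      · exact hend₁ x h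
      · rw [hexit₁ x h]; exact Nat.zero_le _
    rcases hη x with h | h <;> rw [h] at hx ⊢ <;> generalize s.1 x = σ at * <;>
      rcases σ with _ | _ | _ | k <;> simp [count, rank] at *
  obtain ⟨β₂, hβ₂, hst, hcount⟩ := exists_stabilizing hrank h5
  have hs' : s = (s.1, s.2 + 0) := by rw [add_zero]
  have hfin : (fireList Set.univ ρ s β₂).1 =
      (fireList Set.univ (dropStacks s.2 ρ) (s.1, 0) β₂).1 := by
    conv_lhs => rw [hs', fireList_dropStacks]
  have hβ₂' : Admissible Set.univ (fun x σ => x ∈ (I : Set ℤ) ∧ ¬ σ.IsStable) ρ s β₂ := by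
    rw [hs', admissible_dropStacks]; exact hβ₂
  -- Carrying lets nothing out, so all exits come from `β₂`: at most `N` from each neighbour of an
  -- outer site, hence `E = 2 * N`. The total odometer is at most `T + N`.
  refine (card_source_le (ρ := ρ) (β := β₁ ++ β₂) hb (E := 2 * N) (N := T + N) (K := K) (M := M)
    ht ?_ ?_ ?_ ?_ hK ?_).trans_eq (by push_cast; ring)
  · rw [hIco]
    refine admissible_append.2 ⟨hβ₁.imp fun x σ h => ⟨h.1, Nat.zero_lt_of_lt h.2⟩,
      hβ₂'.imp fun x σ h => ⟨h.1, particleRule_active _ x σ h⟩⟩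
  · rw [hIco, fireList_append, ← hs, hfin]; exact hst
  · rw [hIco, fireList_append, ← hs]
    intro x hx
    have e1 := count_fireList_le (ρ := ρ) Set.univ s β₂ x
    rw [hexit₁ x hx] at e1
    have e2 := hcount (x - 1)
    have e3 := hcount (x + 1)
    omega
  · intro x
    rw [List.count_append]
    exact add_le_add (List.count_le_length.trans hlen) (hcount x)
  · intro q hq k hk m hm
    obtain ⟨T', h7, h8⟩ := h6 q hq k hk m hm
    obtain ⟨γ, -, hγ, hrun'⟩ := exists_list_run (D := Set.Icc (b * q) (b * q + b - 1))
      (κ := fun _ => 1) (B := Finset.Icc (b * q) (b * q + b - 1)) T'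
      (feedConfig M (b * q) (b * q + b - 1) k m) ρ
    rw [hrun'] at h7 h8
    refine ⟨γ, hγ.imp fun x σ h => ⟨by simpa using h.1, h.2⟩, fun x hx => ?_, h8⟩
    exact nextSite_eq_none h7 x (by simpa using hx)

/-- No bound on `T` is needed here: the length of the runs that fill the blocks does not enter the
union bound. -/
theorem exists_run_unfinished_le {lam : ℝ≥0∞} (hlam : lam ≠ ∞) {D : Set ℤ} {κ : ℤ → ℕ} {l r : ℤ}
    (hD : ∀ x ∈ Finset.Icc l r, x ∈ D) (c : Config) {δ : ℝ} (hδ : 0 < δ) :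
    ∃ T, (stacksLaw lam).real
      {ρ | nextSite κ (Finset.Icc l r) (run D κ (Finset.Icc l r) T c ρ).1 ≠ none} ≤ δ := by
  have hp := stepProb_pos hlam
  obtain ⟨T, hT⟩ := exists_nat_gt (particleSum (exitTime l r) (Finset.Icc l r) c /
    (stepProb lam * δ))
  refine ⟨T, ?_⟩
  have h := mul_measureReal_run_unfinished_le (κ := κ) lam hD T c
  rw [div_lt_iff₀ (by positivity)] at hT
  have hT0 : 0 < (T : ℝ) := by
    by_contra h0
    have e := particleSum_exitTime_nonneg l r c
    have : (T : ℝ) * (stepProb lam * δ) ≤ 0 :=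
      mul_nonpos_of_nonpos_of_nonneg (not_lt.1 h0) (by positivity)
    linarith
  by_contra hlt
  push Not at hlt
  have := mul_lt_mul_of_pos_left hlt (mul_pos hT0 hp)
  nlinarith

/-- The comparison of the two densities, given bounds on probabilities. -/
theorem card_source_le_of_measureReal {lam : ℝ≥0∞} (hlam : lam ≠ ∞) {b K M T N n : ℕ}
    (hn : n = b * K) (hb : 0 < b) (hK : 0 < K) {η : Config} (hη : ∀ x, η x = num 0 ∨ η x = num 1) {g A A' t δ : ℝ} {a : ℕ}
    (hg : 0 < g) (ht : 0 ≤ t) (hA' : 0 < A') (hT : 0 < T) (hδ : 0 < δ)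
    (h1 : M + g ≤ particleSum (fun _ => 1)
      (Finset.Icc (-(n : ℤ)) (n - 1)) η)
    (h2 : |particleSum (fun z => (z : ℝ))
      (Finset.Icc (-(n : ℤ)) (n - 1)) η| ≤ A)
    (hA : A + A' < a * (g - 2 * a))
    (h3 : 8 * (M * ((n + 1) * n) : ℝ) ≤ T * stepProb lam)
    (h4 : 8 * (M * ((n + 1) * n) : ℝ) ≤ A' ^ 2)
    (h5 : (stacksLaw lam) {ρ | ∃ y ∈ Finset.Icc (-(n : ℤ)) (n - 1),
      (N : ℝ≥0∞) ≤ (odometer ρ η y : ℕ∞)} ≤ 4⁻¹)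
    (h7 : ∀ q ∈ Finset.Ico (-(K : ℤ)) K, (stacksLaw lam).real
      {ρ | t < survivors (Finset.Icc (b * q) (b * q + b - 1)) ρ} ≤ δ)
    (hsum : 2 * K * (T + N + 1) ^ 2 * (2 * δ) ≤ 1 / 4) :
    (M : ℝ) ≤ 2 * K * t + 2 * b + 4 * N := by
  subst hn
  set I := Finset.Icc (-((b * K : ℕ) : ℤ)) ((b * K : ℕ) - 1) with hI
  set μ := stacksLaw lam with hμ
  have hp := stepProb_pos hlam
  have hT' : ∀ (q : ℤ) (k m : ℕ), ∃ T', μ.real {ρ | nextSite (fun _ => 1)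
      (Finset.Icc (b * q) (b * q + b - 1)) (run (Set.Icc (b * q) (b * q + b - 1)) (fun _ => 1)
        (Finset.Icc (b * q) (b * q + b - 1)) T'
          (feedConfig M (b * q) (b * q + b - 1) k m) ρ).1 ≠ none} ≤ δ := fun q k m =>
    exists_run_unfinished_le hlam (fun x hx => by simpa using hx) _ hδ
  choose T' hT' using hT'
  have hW : particleSum (exitTime (-((b * K : ℕ) : ℤ)) ((b * K : ℕ) - 1)) I (sourceConfig M) =
      M * (((b * K : ℕ) + 1) * (b * K : ℕ)) := by
    have : 0 < b * K := Nat.mul_pos hb hK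
    rw [particleSum_sourceConfig _ _ (Finset.mem_Icc.2 (by omega))]
    simp only [exitTime]; push_cast; ring
  set B₃ : Set Stacks := {ρ | nextSite (fun x => (η x).count) I
    (run Set.univ (fun x => (η x).count) I T (sourceConfig M) ρ).1 ≠ none} with hB₃
  set B₄ : Set Stacks := {ρ | A' ≤ |particleSum (fun z => (z : ℝ))
    (Finset.Icc (-((b * K : ℕ) : ℤ) - 1) ((b * K : ℕ) - 1 + 1))
      (run Set.univ (fun x => (η x).count) I T (sourceConfig M) ρ).1|} with hB₄
  set B₅ : Set Stacks := (fun ρ => (run Set.univ (fun x => (η x).count) I T (sourceConfig M) ρ).2) ⁻¹'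
    {ρ | ∃ y ∈ I, (N : ℝ≥0∞) ≤ (odometer ρ η y : ℕ∞)} with hB₅
  set B₆ : ℤ × ℕ × ℕ → Set Stacks := fun i => {ρ | nextSite (fun _ => 1)
      (Finset.Icc (b * i.1) (b * i.1 + b - 1)) (run (Set.Icc (b * i.1) (b * i.1 + b - 1))
        (fun _ => 1) (Finset.Icc (b * i.1) (b * i.1 + b - 1)) (T' i.1 i.2.1 i.2.2)
          (feedConfig M (b * i.1) (b * i.1 + b - 1) i.2.1 i.2.2) ρ).1 ≠ none} with hB₆
  set B₇ : ℤ × ℕ × ℕ → Set Stacks := fun i => (fun ρ => (run (Set.Icc (b * i.1) (b * i.1 + b - 1))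
        (fun _ => 1) (Finset.Icc (b * i.1) (b * i.1 + b - 1)) (T' i.1 i.2.1 i.2.2)
          (feedConfig M (b * i.1) (b * i.1 + b - 1) i.2.1 i.2.2) ρ).2) ⁻¹'
      {ρ | t < survivors (Finset.Icc (b * i.1) (b * i.1 + b - 1)) ρ} with hB₇
  set F : Finset (ℤ × ℕ × ℕ) := Finset.Ico (-(K : ℤ)) K ×ˢ
    (Finset.range (T + N + 1) ×ˢ Finset.range (T + N + 1)) with hF
  have e3 : μ.real B₃ ≤ 1 / 8 := by
    have h := mul_measureReal_run_unfinished_le (κ := fun x => (η x).count) (D := Set.univ) lam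
      (a := -((b * K : ℕ) : ℤ)) (b := (b * K : ℕ) - 1) (fun _ _ => Set.mem_univ _) T
      (sourceConfig M)
    rw [hW] at h
    have hTp : 0 < T * stepProb lam := mul_pos (Nat.cast_pos.2 hT) hp
    by_contra hlt
    push Not at hlt
    have := mul_lt_mul_of_pos_left hlt hTp
    linarith
  have e4 : μ.real B₄ ≤ 1 / 8 := by
    have h := measureReal_run_particleSum_le (κ := fun x => (η x).count) lam
      (a := -((b * K : ℕ) : ℤ)) (b := (b * K : ℕ) - 1) hA' T (sourceConfig M)
    have hJ : 0 < b * K := Nat.mul_pos hb hK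
    rw [hW, particleSum_sourceConfig _ _ (Finset.mem_Icc.2 (by omega))] at h
    refine h.trans ?_
    rw [div_le_iff₀ (by positivity)]
    push_cast at h4 ⊢
    linarith
  have e5 : μ.real B₅ ≤ 1 / 4 := by
    -- The preimage inequality holds for arbitrary sets, so measurability of the event is not
    -- needed; the same applies to the survivors below.
    have h := (measurePreserving_run (D := Set.univ) (κ := fun x => (η x).count) (B := I) lam T
      (sourceConfig M)).measure_preimage_le {ρ | ∃ y ∈ I, (N : ℝ≥0∞) ≤ (odometer ρ η y : ℕ∞)}
    refine (ENNReal.toReal_mono (by simp) (h.trans h5)).trans_eq ?_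
    simp
  have e6 : ∀ i, μ.real (B₆ i) ≤ δ := fun i => hT' i.1 i.2.1 i.2.2
  have e7 : ∀ i ∈ F, μ.real (B₇ i) ≤ δ := by
    intro i hi
    have h := (measurePreserving_run (D := Set.Icc (b * i.1) (b * i.1 + b - 1))
      (κ := fun _ => 1) (B := Finset.Icc (b * i.1) (b * i.1 + b - 1)) lam (T' i.1 i.2.1 i.2.2)
      (feedConfig M (b * i.1) (b * i.1 + b - 1) i.2.1 i.2.2)).measure_preimage_le
      {ρ | t < survivors (Finset.Icc (b * i.1) (b * i.1 + b - 1)) ρ}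
    exact (ENNReal.toReal_mono (measure_ne_top _ _) h).trans
      (h7 i.1 (Finset.mem_product.1 hi).1)
  have e67 : μ.real (⋃ i ∈ F, (B₆ i ∪ B₇ i)) ≤ 1 / 4 := by
    refine (measureReal_biUnion_finset_le F _).trans ?_
    refine (Finset.sum_le_card_nsmul F _ (2 * δ) fun i hi =>
      (measureReal_union_le _ _).trans (by linarith [e6 i, e7 i hi])).trans ?_
    have hc : (F.card : ℝ) = 2 * K * (T + N + 1) ^ 2 := by
      rw [hF, Finset.card_product, Finset.card_product, Int.card_Ico, Finset.card_range]
      have : ((K : ℤ) - -K).toNat = 2 * K := by omega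
      rw [this]; push_cast; ring
    rw [nsmul_eq_mul, hc]
    exact hsum
  -- The total is at most `1/8 + 1/8 + 1/4 + 1/4`, so some stacks avoid all the bad events; the
  -- conclusion no longer involves the stacks.
  have htot : μ.real (B₃ ∪ B₄ ∪ B₅ ∪ ⋃ i ∈ F, (B₆ i ∪ B₇ i)) < 1 := by
    have u1 := measureReal_union_le (μ := μ) (B₃ ∪ B₄ ∪ B₅) (⋃ i ∈ F, (B₆ i ∪ B₇ i))
    have u2 := measureReal_union_le (μ := μ) (B₃ ∪ B₄) B₅
    have u3 := measureReal_union_le (μ := μ) B₃ B₄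
    linarith
  obtain ⟨ρ, hρ⟩ : ∃ ρ, ρ ∉ B₃ ∪ B₄ ∪ B₅ ∪ ⋃ i ∈ F, (B₆ i ∪ B₇ i) := by
    by_contra h
    push Not at h
    rw [Set.eq_univ_of_forall h, probReal_univ] at htot
    exact lt_irrefl _ htot
  simp only [Set.mem_union, Set.mem_iUnion, not_or, not_exists] at hρ
  obtain ⟨⟨⟨g3, g4⟩, g5⟩, g67⟩ := hρ
  refine card_source_le_of_run (ρ := ρ) hb hK hη hg ht h1 h2 hA (T := T) (not_not.1 g3)
    (not_le.1 g4).le (fun y hy => ?_) (fun q hq k hk m hm => ?_)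
  · by_contra h
    push Not at h
    exact g5 ⟨y, hy, by rw [← ENat.toENNReal_coe]; exact ENat.toENNReal_le.2 h⟩
  · have hi : (q, k, m) ∈ F := Finset.mem_product.2 ⟨hq, Finset.mem_product.2
      ⟨Finset.mem_range.2 (Nat.lt_succ_of_le hk), Finset.mem_range.2 (Nat.lt_succ_of_le hm)⟩⟩
    have g := g67 (q, k, m) hi
    exact ⟨T' q k m, not_not.1 g.1, not_lt.1 g.2⟩

end ARW

/-! ### Typical configurations and the choice of parameters. -/

namespace ARW

open SiteState

/-- A Bernoulli configuration that has the typical number of particles, is balanced, and has a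
small odometer with a large probability. -/
theorem exists_typical_config {lam : ℝ≥0∞} {ζ : unitInterval}
    (hE : ∫⁻ ω, ((odometer ω.1 ω.2 0 : ℕ∞) : ℝ≥0∞) ^ 3
      ∂((stacksLaw lam).prod (bernoulliConfigLaw ζ)) < ∞) {ε δ : ℝ} (hε : 0 < ε) (hδ : 0 < δ)
    {n N : ℕ} (hn : 0 < n) (hN : ε * n ≤ N) (h1 : 32 ≤ ε ^ 2 * n) (h2 : 32 ≤ δ ^ 2 * n)
    (h3 : 25 * (∫⁻ ω, ((odometer ω.1 ω.2 0 : ℕ∞) : ℝ≥0∞) ^ 3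
      ∂((stacksLaw lam).prod (bernoulliConfigLaw ζ))).toReal ≤ ε ^ 3 * n) :
    ∃ η : Config, (∀ x, η x = num 0 ∨ η x = num 1) ∧
      |particleSum (fun _ => 1) (Finset.Icc (-(n : ℤ)) (n - 1)) η - ζ * (2 * n)| < ε * n ∧
      |particleSum (fun z => (z : ℝ)) (Finset.Icc (-(n : ℤ)) (n - 1)) η| ≤ δ * n ^ 2 + n ∧
      (stacksLaw lam) {ρ | ∃ y ∈ Finset.Icc (-(n : ℤ)) (n - 1),
        (N : ℝ≥0∞) ≤ (odometer ρ η y : ℕ∞)} ≤ 4⁻¹ := by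
  set I := Finset.Icc (-(n : ℤ)) (n - 1) with hI
  set ν := bernoulliConfigLaw ζ with hν
  set E := ∫⁻ ω, ((odometer ω.1 ω.2 0 : ℕ∞) : ℝ≥0∞) ^ 3 ∂((stacksLaw lam).prod ν) with hEdef
  have hn0 : (0 : ℝ) < n := Nat.cast_pos.2 hn
  have hn1 : (1 : ℝ) ≤ n := Nat.one_le_cast.2 hn
  have hcard : I.card = 2 * n := by rw [hI, Int.card_Icc]; omega
  have hcard' : (I.card : ℝ) = 2 * n := by rw [hcard]; push_cast; ring
  -- The interval `[-n, n - 1]` is not symmetric; this is the source of the term `+ n` in the bound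
  -- on the position sum.
  have hsumI : ∑ x ∈ I, (x : ℝ) = -n := by
    have hrec : ∀ m : ℕ, ∑ x ∈ Finset.Icc (-(m : ℤ)) (m - 1), (x : ℝ) = -m := by
      intro m
      induction m with
      | zero => simp
      | succ m ih =>
        have h : Finset.Icc (-((m + 1 : ℕ) : ℤ)) ((m + 1 : ℕ) - 1) =
            insert (-(m : ℤ) - 1) (insert (m : ℤ) (Finset.Icc (-(m : ℤ)) (m - 1))) := by
          ext z; simp only [Finset.mem_Icc, Finset.mem_insert]; omega
        rw [h, Finset.sum_insert, Finset.sum_insert, ih]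
        · push_cast; ring
        · simp
        · simp only [Finset.mem_Icc, Finset.mem_insert]; omega
    exact hrec n
  have b1 := bernoulliConfigLaw_particleSum_le ζ (fun _ => 1) I (C := 1) (A := ε * n)
    (by simp) (by positivity)
  have b2 := bernoulliConfigLaw_particleSum_le ζ (fun z => (z : ℝ)) I (C := n) (A := δ * n ^ 2)
    (fun x hx => by
      have := Finset.mem_Icc.1 hx
      rw [abs_le]
      have e1 : (-(n : ℤ) : ℝ) ≤ x := by exact_mod_cast this.1
      have e2 : (x : ℝ) ≤ n := by exact_mod_cast (by omega : x ≤ (n : ℤ))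
      push_cast at e1
      exact ⟨e1, e2⟩) (by positivity)
  have hN0 : 0 < (N : ℝ) := lt_of_lt_of_le (by positivity) hN
  have b3 := bernoulliConfigLaw_odometer_le lam ζ I (N := N) (Nat.cast_pos.1 hN0)
  have b0 : ν {η | ¬ ∀ x, η x = num 0 ∨ η x = num 1} = 0 := ae_bernoulliConfigLaw ζ
  rw [hcard'] at b1 b2
  have c1 : ENNReal.ofReal (2 * n * 1 ^ 2 / (ε * n) ^ 2) ≤ ENNReal.ofReal (1 / 16) := by
    refine ENNReal.ofReal_le_ofReal ?_
    rw [div_le_div_iff₀ (by positivity) (by norm_num)]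
    nlinarith
  have c2 : ENNReal.ofReal (2 * n * n ^ 2 / (δ * n ^ 2) ^ 2) ≤ ENNReal.ofReal (1 / 16) := by
    refine ENNReal.ofReal_le_ofReal ?_
    rw [div_le_div_iff₀ (by positivity) (by norm_num)]
    have := mul_le_mul_of_nonneg_right h2 (by positivity : (0 : ℝ) ≤ n ^ 3)
    nlinarith
  have c3 : 4 * (I.card * (E / (N : ℝ≥0∞) ^ 3)) ≤ ENNReal.ofReal (8 / 25) := by
    have e2 : 4 * (I.card * (E / (N : ℝ≥0∞) ^ 3)) =
        ENNReal.ofReal (4 * (I.card * (E.toReal / (N : ℝ) ^ 3))) := by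
      rw [ENNReal.ofReal_mul (by norm_num : (0 : ℝ) ≤ 4),
        ENNReal.ofReal_mul (Nat.cast_nonneg (α := ℝ) I.card),
        ENNReal.ofReal_div_of_pos (pow_pos hN0 3), ENNReal.ofReal_pow hN0.le,
        ENNReal.ofReal_toReal hE.ne, ENNReal.ofReal_natCast, ENNReal.ofReal_natCast,
        ENNReal.ofReal_ofNat]
    rw [e2, hcard']
    refine ENNReal.ofReal_le_ofReal ?_
    have e0 : 0 ≤ E.toReal := ENNReal.toReal_nonneg
    have e3 : E.toReal / (N : ℝ) ^ 3 ≤ E.toReal / (ε * n) ^ 3 := by gcongr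
    have e4 : E.toReal / (ε * n) ^ 3 ≤ 1 / (25 * n) := by
      rw [div_le_div_iff₀ (by positivity) (by positivity)]
      have g1 := mul_le_mul_of_nonneg_right h3 hn0.le
      have g2 : ε ^ 3 * n * n ≤ ε ^ 3 * n * n * n := le_mul_of_one_le_right (by positivity) hn1
      nlinarith
    have e5 : 4 * (2 * n * (1 / (25 * (n : ℝ)))) = 8 / 25 := by field_simp; norm_num
    rw [← e5]
    exact mul_le_mul_of_nonneg_left (mul_le_mul_of_nonneg_left (e3.trans e4) (by positivity))
      (by norm_num)
  set B₁ : Set Config := {η | ε * n ≤ |particleSum (fun _ => 1) I η - ζ * ∑ x ∈ I, (1 : ℝ)|}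
  set B₂ : Set Config := {η | δ * n ^ 2 ≤ |particleSum (fun z => (z : ℝ)) I η -
    ζ * ∑ x ∈ I, (x : ℝ)|}
  set B₃ : Set Config := {η | 4⁻¹ ≤
        stacksLaw lam {ρ | ∃ y ∈ I, (N : ℝ≥0∞) ≤ (odometer ρ η y : ℕ∞)}}
  set B₀ : Set Config := {η | ¬ ∀ x, η x = num 0 ∨ η x = num 1}
  have htot : ν (B₀ ∪ B₁ ∪ B₂ ∪ B₃) < 1 := by
    calc ν (B₀ ∪ B₁ ∪ B₂ ∪ B₃) ≤ ν B₀ + ν B₁ + ν B₂ + ν B₃ :=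
          (measure_union_le _ _).trans (add_le_add_left ((measure_union_le _ _).trans
            (add_le_add_left (measure_union_le _ _) _)) _)
      _ ≤ 0 + ENNReal.ofReal (1 / 16) + ENNReal.ofReal (1 / 16) + ENNReal.ofReal (8 / 25) :=
          add_le_add (add_le_add (add_le_add b0.le (b1.trans c1)) (b2.trans c2)) (b3.trans c3)
      _ = ENNReal.ofReal (1 / 16 + 1 / 16 + 8 / 25) := by
          rw [zero_add, ← ENNReal.ofReal_add (by norm_num) (by norm_num),
            ← ENNReal.ofReal_add (by norm_num) (by norm_num)]
      _ < 1 := by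
          rw [← ENNReal.ofReal_one]
          exact (ENNReal.ofReal_lt_ofReal_iff (by norm_num)).2 (by norm_num)
  obtain ⟨η, hη⟩ : ∃ η, η ∉ B₀ ∪ B₁ ∪ B₂ ∪ B₃ := by
    by_contra h
    push Not at h
    rw [Set.eq_univ_of_forall h, measure_univ] at htot
    exact lt_irrefl _ htot
  simp only [Set.mem_union, not_or] at hη
  obtain ⟨⟨⟨g0, g1⟩, g2⟩, g3⟩ := hη
  refine ⟨η, not_not.1 g0, ?_, ?_, (not_le.1 g3).le⟩
  · have g1' : ¬ (ε * n ≤ |particleSum (fun _ => 1) I η - ζ * ∑ x ∈ I, (1 : ℝ)|) := g1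
    rw [Finset.sum_const, nsmul_eq_mul, hcard', mul_one] at g1'
    exact not_le.1 g1'
  · have g2' : ¬ (δ * n ^ 2 ≤ |particleSum (fun z => (z : ℝ)) I η - ζ * ∑ x ∈ I, (x : ℝ)|) := g2
    have h := not_le.1 g2'
    rw [hsumI] at h
    have hz0 := ζ.2.1
    have hz1 := ζ.2.2
    have h' := abs_lt.1 h
    have k1 : (ζ : ℝ) * n ≤ n := mul_le_of_le_one_left hn0.le hz1
    have k2 : 0 ≤ (ζ : ℝ) * n := mul_nonneg hz0 hn0.le
    rw [abs_le]
    constructor <;> linarith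

set_option maxHeartbeats 1000000 in
/-- If the odometer at density `ζ` has a finite third moment, then long intervals retain any
density `z < ζ` with a probability that is not too small. -/
theorem not_forall_measureReal_le {lam : ℝ≥0∞} (hlam : lam ≠ ∞) {ζ : unitInterval}
    (hE : ∫⁻ ω, ((odometer ω.1 ω.2 0 : ℕ∞) : ℝ≥0∞) ^ 3
      ∂((stacksLaw lam).prod (bernoulliConfigLaw ζ)) < ∞) {z : ℝ} (hz0 : 0 ≤ z) (hz : z < ζ)
    (b₀ : ℕ) : ¬ ∀ l r : ℤ, b₀ ≤ (Finset.Icc l r).card → (stacksLaw lam).real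
      {ρ | z * (Finset.Icc l r).card < survivors (Finset.Icc l r) ρ} ≤
        (((Finset.Icc l r).card : ℝ) ^ 20)⁻¹ := by
  intro hsurv
  have hp := stepProb_pos hlam
  obtain ⟨E, hEdef⟩ : ∃ E, E = (∫⁻ ω, ((odometer ω.1 ω.2 0 : ℕ∞) : ℝ≥0∞) ^ 3
    ∂((stacksLaw lam).prod (bernoulliConfigLaw ζ))).toReal := ⟨_, rfl⟩
  have hζ1 : (ζ : ℝ) ≤ 1 := ζ.2.2
  -- The errors add up to about `8 * ε * n`, while `M` exceeds `2 * n * z` by about `30 * ε * n`.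
  obtain ⟨ε, hε⟩ : ∃ ε : ℝ, ε = (ζ - z) / 16 := ⟨_, rfl⟩
  have hε0 : 0 < ε := by rw [hε]; linarith
  have hε1 : ε ≤ 1 / 16 := by rw [hε]; linarith
  obtain ⟨δ, hδ⟩ : ∃ δ : ℝ, δ = ε ^ 2 / 64 := ⟨_, rfl⟩
  have hδ0 : 0 < δ := by rw [hδ]; positivity
  -- The number of blocks is fixed and only `b` tends to infinity; this `K` makes the two partly
  -- visited blocks cost at most `4 * ε * n`.
  obtain ⟨K, hK⟩ := exists_nat_gt (1 / (2 * ε))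
  have hK0 : 0 < K := by
    have : (0 : ℝ) < K := lt_trans (by positivity) hK
    exact_mod_cast this
  have ev : ∀ c : ℝ, ∀ᶠ b : ℕ in atTop, c ≤ b := fun c =>
    tendsto_natCast_atTop_atTop.eventually_ge_atTop c
  obtain ⟨b, hb0, hb1, hb2, hb3, hb4, hb5, hb6⟩ := ((eventually_ge_atTop b₀).and
    ((ev (8 / ε)).and ((ev (33 / ε ^ 2)).and ((ev (32 / δ ^ 2)).and ((ev (25 * E / ε ^ 3)).and
      ((ev (32 / stepProb lam)).and (ev (144 * K ^ 9)))))))).exists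
  obtain ⟨n, hn⟩ : ∃ n, n = b * K := ⟨_, rfl⟩
  have hbR : (0 : ℝ) < b := lt_of_lt_of_le (by positivity) hb1
  have hb : 0 < b := by exact_mod_cast hbR
  have hbR1 : (1 : ℝ) ≤ b := by exact_mod_cast hb
  have hKR : (1 : ℝ) ≤ K := by exact_mod_cast hK0
  have hnR : (n : ℝ) = b * K := by rw [hn]; push_cast; ring
  have hbn : (b : ℝ) ≤ n := by rw [hnR]; exact le_mul_of_one_le_right hbR.le hKR
  have hn0 : 0 < n := hn ▸ Nat.mul_pos hb hK0
  have hnpos : (0 : ℝ) < n := by exact_mod_cast hn0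
  have n1 : 8 ≤ ε * n := by have := (div_le_iff₀ hε0).1 (hb1.trans hbn); linarith
  have n2 : 33 ≤ ε ^ 2 * n := by
    have := (div_le_iff₀ (by positivity)).1 (hb2.trans hbn); linarith
  have n3 : 32 ≤ δ ^ 2 * n := by
    have := (div_le_iff₀ (by positivity)).1 (hb3.trans hbn); linarith
  have n4 : 25 * E ≤ ε ^ 3 * n := by
    have := (div_le_iff₀ (by positivity)).1 (hb4.trans hbn); linarith
  have n5 : 32 ≤ stepProb lam * n := by
    have := (div_le_iff₀ hp).1 (hb5.trans hbn); linarith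
  have n128 : (128 : ℝ) ≤ n := by
    have h1 : ε ^ 2 ≤ (1 / 16) ^ 2 := pow_le_pow_left₀ hε0.le hε1 2
    have h2 := mul_le_mul_of_nonneg_right h1 hnpos.le
    linarith
  obtain ⟨N, hN⟩ : ∃ N : ℕ, N = ⌈ε * n⌉₊ := ⟨_, rfl⟩
  have hN1 : ε * n ≤ N := hN ▸ Nat.le_ceil _
  have hN2 : (N : ℝ) < ε * n + 1 := hN ▸ Nat.ceil_lt_add_one (by positivity)
  have hNn : (N : ℝ) ≤ n - 1 := by
    have := mul_le_mul_of_nonneg_right hε1 hnpos.le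
    linarith
  obtain ⟨η, hη, e1, e2, e3⟩ := exists_typical_config hE hε0 hδ0 hn0 hN1 (by linarith) n3
    (hEdef ▸ n4)
  have hζε : 0 ≤ 2 * n * (ζ - ε : ℝ) := by
    have : 0 ≤ (ζ : ℝ) - ε := by rw [hε]; linarith
    positivity
  obtain ⟨M, hM⟩ : ∃ M : ℕ, M = ⌊2 * n * (ζ - ε : ℝ)⌋₊ := ⟨_, rfl⟩
  have hM1 : (M : ℝ) ≤ 2 * n * (ζ - ε) := hM ▸ Nat.floor_le hζε
  have hM2 : 2 * n * (ζ - ε : ℝ) < M + 1 := hM ▸ Nat.lt_floor_add_one _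
  have hM3 : (M : ℝ) ≤ 2 * n :=
    hM1.trans (mul_le_of_le_one_right (by positivity) (by linarith))
  obtain ⟨a, ha⟩ : ∃ a : ℕ, a = ⌊ε * n / 4⌋₊ := ⟨_, rfl⟩
  have ha1 : (a : ℝ) ≤ ε * n / 4 := ha ▸ Nat.floor_le (by positivity)
  have ha2 : ε * n / 4 < a + 1 := ha ▸ Nat.lt_floor_add_one _
  have hMn : 8 * (M * ((n + 1) * n) : ℝ) ≤ 32 * n ^ 3 := by
    have h1 : (n : ℝ) + 1 ≤ 2 * n := by linarith
    have h2 : (M : ℝ) * ((n + 1) * n) ≤ (2 * n) * ((2 * n) * n) := by gcongr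
    have h3 : (2 * n : ℝ) * ((2 * n) * n) = 4 * n ^ 3 := by ring
    linarith
  have q1 : M + ε * n ≤ particleSum (fun _ => 1) (Finset.Icc (-(n : ℤ)) (n - 1)) η := by
    have := (abs_lt.1 e1).1
    linarith
  have q2 : δ * n ^ 2 + n + δ * n ^ 2 < a * (ε * n - 2 * a) := by
    have h1 : (ε * n / 8) * (ε * n / 2) ≤ a * (ε * n - 2 * a) := by
      apply mul_le_mul
      · linarith
      · linarith
      · positivity
      · positivity
    have h2 : 33 * (n : ℝ) ≤ ε ^ 2 * n * n := mul_le_mul_of_nonneg_right n2 hnpos.le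
    have h3 : δ * n ^ 2 = ε ^ 2 * n * n / 64 := by rw [hδ]; ring
    have h4 : (ε * n / 8) * (ε * n / 2) = ε ^ 2 * n * n / 16 := by ring
    linarith
  -- The total exit time is of order `n ^ 3`, so a run of length `T = n ^ 4` almost always finishes.
  have q3 : 8 * (M * ((n + 1) * n) : ℝ) ≤ (n ^ 4 : ℕ) * stepProb lam := by
    refine hMn.trans ?_
    push_cast
    have := mul_le_mul_of_nonneg_right n5 (by positivity : (0 : ℝ) ≤ n ^ 3)
    linarith
  have q4 : 8 * (M * ((n + 1) * n) : ℝ) ≤ (δ * n ^ 2) ^ 2 := by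
    refine hMn.trans ?_
    have := mul_le_mul_of_nonneg_right n3 (by positivity : (0 : ℝ) ≤ n ^ 3)
    linarith
  have q5 : ∀ q ∈ Finset.Ico (-(K : ℤ)) K, (stacksLaw lam).real
      {ρ | z * b < survivors (Finset.Icc (b * q) (b * q + b - 1)) ρ} ≤ ((b : ℝ) ^ 20)⁻¹ := by
    intro q _
    have hc : (Finset.Icc ((b : ℤ) * q) (b * q + b - 1)).card = b := by
      rw [Int.card_Icc]; omega
    have := hsurv (b * q) (b * q + b - 1) (by rw [hc]; exact hb0)
    rwa [hc] at this
  -- The number of triples `(q, k, m)` is of order `n ^ 8` for fixed `K`; decay `b ^ (-9)` would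
  -- suffice.
  have q6 : 2 * K * (((n ^ 4 : ℕ) : ℝ) + N + 1) ^ 2 * (2 * ((b : ℝ) ^ 20)⁻¹) ≤ 1 / 4 := by
    have h1 : ((n ^ 4 : ℕ) : ℝ) + N + 1 ≤ 2 * n ^ 4 := by
      push_cast
      have : (n : ℝ) ≤ n ^ 4 := le_self_pow₀ (by linarith) (by norm_num)
      linarith
    have h2 : (((n ^ 4 : ℕ) : ℝ) + N + 1) ^ 2 ≤ (2 * n ^ 4) ^ 2 := by gcongr
    have h3 : (b : ℝ) ^ 9 ≤ b ^ 20 := pow_le_pow_right₀ hbR1 (by norm_num)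
    have h4 : 2 * K * (((n ^ 4 : ℕ) : ℝ) + N + 1) ^ 2 * (2 * ((b : ℝ) ^ 20)⁻¹) ≤
        2 * K * (2 * n ^ 4) ^ 2 * (2 * ((b : ℝ) ^ 9)⁻¹) := by gcongr
    refine h4.trans ?_
    rw [hnR]
    have h5 : 2 * K * (2 * (b * K : ℝ) ^ 4) ^ 2 * (2 * ((b : ℝ) ^ 9)⁻¹) = 16 * K ^ 9 / b := by
      field_simp; ring
    rw [h5, div_le_div_iff₀ hbR (by norm_num)]
    linarith
  have hmain := card_source_le_of_measureReal hlam hn hb hK0 hη (mul_pos hε0 hnpos)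
    (mul_nonneg hz0 hbR.le) (mul_pos hδ0 (pow_pos hnpos 2)) (pow_pos hn0 4)
    (inv_pos.2 (pow_pos hbR 20)) q1 e2 q2 q3 q4 e3 q5 q6
  have hK2 : 2 * (b : ℝ) ≤ 4 * ε * n := by
    have h1 : 1 ≤ K * (2 * ε) := ((div_lt_iff₀ (by positivity)).1 hK).le
    have := mul_le_mul_of_nonneg_left h1 hbR.le
    have h2 : 4 * ε * n = 2 * (b * (K * (2 * ε))) := by rw [hnR]; ring
    linarith
  have hzb : 2 * (K : ℝ) * (z * b) = 2 * n * z := by rw [hnR]; ring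
  have hζz : (ζ : ℝ) = z + 16 * ε := by rw [hε]; ring
  rw [hzb] at hmain
  rw [hζz] at hM2
  have e4 : 2 * n * (z + 16 * ε - ε) = 2 * n * z + 30 * (ε * n) := by ring
  rw [e4] at hM2
  linarith

end ARW

/-! ### Infinite sleep rate, properties of the inner density, and conclusion. -/

namespace ARW

open SiteState

/-- If all the instructions are sleep instructions, then no particle ever moves. -/
theorem count_fireList_of_sleep (D : Set ℤ) {ρ : Stacks} (hρ : ∀ i, ρ i = .sleep) (α : List ℤ)
    (s : Config × (ℤ → ℕ)) (y : ℤ) : ((fireList D ρ s α).1 y).count = (s.1 y).count := by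
  induction α generalizing s with
  | nil => rfl
  | cons x α ih =>
    rw [fireList, ih]
    simp only [fire, hρ, applyInstr]
    rcases eq_or_ne y x with rfl | h
    · rw [Function.update_self, count_trySleep]
    · rw [Function.update_of_ne h]

theorem survivors_of_sleep {ρ : Stacks} (hρ : ∀ i, ρ i = .sleep) (I : Finset ℤ) :
    survivors I ρ = I.card := by
  have h : ∀ x ∈ I, (stabilization (I : Set ℤ) ρ (fullConfig I) x).count = 1 := by
    intro x hx
    have h0 : (fullConfig I x).count = 1 := by simp [fullConfig, hx, count]
    unfold stabilization
    split_ifs with h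
    · rw [count_fireList_of_sleep _ hρ, h0]
    · exact h0
  rw [survivors, Finset.sum_congr rfl h]
  simp

theorem ae_stacksLaw_top : ∀ᵐ ρ ∂stacksLaw ∞, ∀ i, ρ i = Instr.sleep := by
  rw [ae_all_iff]
  intro i
  have h : MeasurePreserving (Function.eval i) (stacksLaw ∞) (instrLaw ∞) :=
    measurePreserving_eval_infinitePi (fun _ : ℤ × ℕ => instrLaw ∞) i
  refine h.quasiMeasurePreserving.ae (p := fun j => j = Instr.sleep) ?_
  have : instrLaw ∞ = Measure.dirac Instr.sleep := by simp [instrLaw]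
  rw [this]
  exact (ae_dirac_iff (MeasurableSet.of_discrete (s := {j | j = Instr.sleep}))).2 rfl

/-- The densities that enter the definition of the inner density of `I`. -/
def retainedDensities (lam : ℝ≥0∞) (I : Finset ℤ) : Set ℝ :=
  {ζ : ℝ | 0 < ζ ∧
    stacksLaw lam {ρ | ζ * (I.card : ℝ) < (survivors I ρ : ℝ)} ≤ ((I.card : ℝ≥0∞) ^ 20)⁻¹}

theorem one_mem_retainedDensities (lam : ℝ≥0∞) (I : Finset ℤ) :
    1 ∈ retainedDensities lam I := by
  refine ⟨one_pos, ?_⟩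
  have : {ρ : Stacks | (1 : ℝ) * I.card < survivors I ρ} = ∅ := by
    ext ρ
    have : (survivors I ρ : ℝ) ≤ I.card := by exact_mod_cast survivors_le_card I ρ
    simpa using this
  rw [this, measure_empty]
  exact zero_le

theorem bddBelow_retainedDensities (lam : ℝ≥0∞) (I : Finset ℤ) :
    BddBelow (retainedDensities lam I) := ⟨0, fun _ h => h.1.le⟩

theorem zetaInOf_nonneg (lam : ℝ≥0∞) (I : Finset ℤ) : 0 ≤ zetaInOf lam I :=
  Real.sInf_nonneg fun _ h => h.1.le

theorem zetaInOf_le_one (lam : ℝ≥0∞) (I : Finset ℤ) : zetaInOf lam I ≤ 1 :=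
  csInf_le (bddBelow_retainedDensities lam I) (one_mem_retainedDensities lam I)

/-- Above the inner density of `I`, few particles are retained. -/
theorem measureReal_le_of_zetaInOf_lt {lam : ℝ≥0∞} {I : Finset ℤ} {z : ℝ}
    (h : zetaInOf lam I < z) :
    (stacksLaw lam).real {ρ | z * I.card < survivors I ρ} ≤ ((I.card : ℝ) ^ 20)⁻¹ := by
  obtain ⟨ζ, hζ, hz⟩ := exists_lt_of_csInf_lt ⟨1, one_mem_retainedDensities lam I⟩ h
  -- The empty set needs its own argument: the inverse of `0 ^ 20` is `0` in the reals, but `∞` in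
  -- the definition of the inner density.
  rcases I.card.eq_zero_or_pos with hc | hc
  · have : {ρ : Stacks | z * I.card < survivors I ρ} = ∅ := by
      ext ρ
      have := survivors_le_card I ρ
      have h0 : survivors I ρ = 0 := by omega
      simp [hc, h0]
    rw [this]
    simp
  have hle : (stacksLaw lam) {ρ | z * I.card < survivors I ρ} ≤ ((I.card : ℝ≥0∞) ^ 20)⁻¹ := by
    refine (measure_mono fun ρ hρ => ?_).trans hζ.2
    exact (mul_le_mul_of_nonneg_right hz.le (Nat.cast_nonneg (α := ℝ) _)).trans_lt hρ
  have hne : ((I.card : ℝ≥0∞) ^ 20)⁻¹ ≠ ∞ :=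
    ENNReal.inv_ne_top.2 (pow_ne_zero _ (Nat.cast_ne_zero.2 hc.ne'))
  refine (ENNReal.toReal_mono hne hle).trans_eq ?_
  rw [ENNReal.toReal_inv, ENNReal.toReal_pow, ENNReal.toReal_natCast]

/-- The filter of the intervals whose length tends to infinity. -/
theorem neBot_comap_card_Icc :
    (comap (fun p : ℤ × ℤ => (Finset.Icc p.1 p.2).card) atTop).NeBot := by
  rw [comap_neBot_iff]
  intro t ht
  obtain ⟨n, hn⟩ := mem_atTop_sets.1 ht
  refine ⟨(1, n), hn _ ?_⟩
  simp

/-- For intervals that are long enough, few particles are retained above the inner density. -/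
theorem exists_forall_measureReal_le {lam : ℝ≥0∞} {z : ℝ} (h : zetaIn lam < z) :
    ∃ b₀ : ℕ, ∀ l r : ℤ, b₀ ≤ (Finset.Icc l r).card → (stacksLaw lam).real
      {ρ | z * (Finset.Icc l r).card < survivors (Finset.Icc l r) ρ} ≤
        (((Finset.Icc l r).card : ℝ) ^ 20)⁻¹ := by
  have hev := eventually_lt_of_limsup_lt h (isBoundedUnder_of ⟨1, fun _ => zetaInOf_le_one _ _⟩)
  obtain ⟨b₀, hb⟩ := eventually_atTop.1 (eventually_comap.1 hev)
  exact ⟨b₀, fun l r hlr => measureReal_le_of_zetaInOf_lt (hb _ hlr (l, r) rfl)⟩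

theorem zetaIn_nonneg (lam : ℝ≥0∞) : 0 ≤ zetaIn lam := by
  have := neBot_comap_card_Icc
  exact le_limsup_of_frequently_le (Frequently.of_forall fun _ => zetaInOf_nonneg _ _)
    (isBoundedUnder_of ⟨1, fun _ => zetaInOf_le_one _ _⟩)

theorem one_le_zetaIn_top : 1 ≤ zetaIn ∞ := by
  by_contra! h
  obtain ⟨z, hz, hz1⟩ := exists_between h
  obtain ⟨b₀, hb⟩ := exists_forall_measureReal_le hz
  have hc : (Finset.Icc (1 : ℤ) (b₀ + 2 : ℕ)).card = b₀ + 2 := by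
    rw [Int.card_Icc]; omega
  have h1 := hb 1 (b₀ + 2 : ℕ) (by rw [hc]; omega)
  rw [hc] at h1
  have h2 : (stacksLaw ∞) {ρ | z * (b₀ + 2 : ℕ) < survivors (Finset.Icc 1 (b₀ + 2 : ℕ)) ρ} = 1 := by
    rw [← measure_univ (μ := stacksLaw ∞)]
    refine measure_congr (eventuallyEq_univ.2 ?_)
    filter_upwards [ae_stacksLaw_top] with ρ hρ
    rw [survivors_of_sleep hρ, hc]
    exact mul_lt_of_lt_one_left (by positivity) hz1
  rw [Measure.real, h2, ENNReal.toReal_one] at h1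
  have h3 : (1 : ℝ) < ((b₀ + 2 : ℕ) : ℝ) ^ 20 :=
    one_lt_pow₀ (by push_cast; linarith [Nat.cast_nonneg (α := ℝ) b₀]) (by norm_num)
  exact absurd h1 (not_le.2 (inv_lt_one_of_one_lt₀ h3))

/-- Nonnegativity of `zetaIn` covers an empty set of densities, and at `lam = ∞` the trivial bound
`ζ ≤ 1` suffices. -/
theorem zetaOut_le_zetaIn (lam : ℝ≥0∞) : zetaOut lam ≤ zetaIn lam := by
  refine Real.sSup_le ?_ (zetaIn_nonneg lam)
  rintro _ ⟨ζ, rfl, -, -, hE⟩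
  rcases eq_or_ne lam ∞ with rfl | hlam
  · exact ζ.2.2.trans one_le_zetaIn_top
  by_contra! h
  obtain ⟨z, hz, hz1⟩ := exists_between h
  obtain ⟨b₀, hb⟩ := exists_forall_measureReal_le hz
  exact not_forall_measureReal_le hlam hE ((zetaIn_nonneg lam).trans hz.le) hz1 b₀ hb

end ARW

theorem mainTheorem2 (lam : ℝ≥0∞) (hlam : 0 < lam) :
    ARW.zetaOut lam ≤ ARW.zetaIn lam :=
  ARW.zetaOut_le_zetaIn lam
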